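/- For integers $d_1\ge d_2\ge 1$ let $\overline G$ be a truncated $d_1\times d_2$ Ginibre matrix, that is, a real random matrix with i.i.d. $\mathcal N(0,1/d_1)$ entries, conditioned on the event that its operator norm is at most $3$ and its squared Frobenius norm is at least $d_2/2$. Let $A$ and $B$ be real diagonal matrices of sizes $d_1\times d_1$ and $d_2\times d_2$ with positive diagonal entries and $\mathrm{Tr}(A)+\mathrm{Tr}(B)=1$; let $a$ and $b$ be the smallest diagonal entries of $A$ and $B$, and assume that all diagonal entries of $A$ are at most $2a$ and all those of $B$ are at most $2b$. For $\varepsilon>0$ consider the task of distinguishing, from $n$ copies of an unknown state $\rho$, $$H_0:\ \rho=\begin{pmatrix}A&0\\0&B\end{pmatrix}\qquad\text{and}\qquad H_1:\ \rho=\begin{pmatrix}A&\frac{\varepsilon}{d_2}\overline G\\ \frac{\varepsilon}{d_2}\overline G^{\dagger}&B\end{pmatrix}$$ (under $H_1$, $\overline G$ is drawn once and all $n$ copies are in the resulting state). An algorithm with incoherent measurements measures the $n$ copies one after the other, each by a POVM with finitely many outcomes that may depend on the previous outcomes, and then answers $H_0$ or $H_1$ as a function of the $n$ outcomes. It distinguishes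 with success probability $p$ if, under each of $H_0$ and $H_1$, its answer is right with probability at least $p$. Theorem. For every $p>1/2$ (for example $p=2/3$) there are a constant $c>0$ and an integer $D$, depending only on $p$, such that the following holds whenever, in addition, $$d_1\ge D,\qquad \varepsilon\le\frac1{10^6}\cdot\frac{d_2\sqrt{ab}}{\log(1/a)},\qquad d_1\sqrt a\le d_2\sqrt b .$$ Every algorithm with incoherent, possibly adaptive, measurements that distinguishes $H_0$ from $H_1$ with success probability $p$ uses $$n\ \ge\ c\cdot\frac{d_1^{1/2}d_2}{\varepsilon^2}$$ copies of $\rho$. -/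

import Mathlib

open MeasureTheory ProbabilityTheory
open scoped Matrix ComplexOrder

noncomputable section

/-- A positive operator valued measurement on the space with orthonormal basis indexed by `ι`:
a finite family of positive semidefinite complex matrices that sums to the identity. -/
structure POVM (ι : Type*) [Fintype ι] [DecidableEq ι] (Z : Type*) [Fintype Z] where
  /-- the measurement operator of each outcome -/
  elem : Z → Matrix ι ι ℂ
  posSemidef : ∀ z, (elem z).PosSemidef
  sum_eq_one : ∑ z, elem z = 1

/-- Born's rule: the probability `Tr (ρ M_z)` of outcome `z` when `ρ` is measured. -/
def POVM.prob {ι Z : Type*} [Fintype ι] [DecidableEq ι] [Fintype Z]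
    (P : POVM ι Z) (ρ : Matrix ι ι ℂ) (z : Z) : ℝ :=
  (ρ * P.elem z).trace.re

/-- A learning tree of depth `n`: `n` copies are measured one after the other, and the POVM
applied to copy `t` may depend on the `t` outcomes observed before.  A node at depth `t` is the
string of these outcomes.  Outcomes are labelled by a common finite alphabet `Fin k`; this is no
restriction, because a tree of finite depth uses finitely many POVMs, each with finitely many
outcomes, and a POVM may be padded with zero operators.  The POVM elements may have any rank, so
that trees built from rank-one POVMs are a special case; elements may also be repeated up to
scaling, so that internal randomness of the learner is covered. -/
structure LearningTree (ι : Type*) [Fintype ι] [DecidableEq ι] (n : ℕ) where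
  /-- size of the outcome alphabet -/
  k : ℕ
  /-- the measurement made at the node `x` of depth `t` -/
  povm : (t : Fin n) → (Fin t → Fin k) → POVM ι (Fin k)

/-- The leaves of a tree: the strings of `n` outcomes. -/
abbrev LearningTree.Leaf {ι : Type*} [Fintype ι] [DecidableEq ι] {n : ℕ}
    (T : LearningTree ι n) : Type :=
  Fin n → Fin T.k

/-- The probability of reaching the leaf `x` when all `n` copies are in the state `ρ`: the product
of the transition probabilities along the path from the root to `x`. -/
def LearningTree.leafProb {ι : Type*} [Fintype ι] [DecidableEq ι] {n : ℕ}
    (T : LearningTree ι n) (ρ : Matrix ι ι ℂ) (x : T.Leaf) : ℝ :=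
  ∏ t : Fin n, (T.povm t fun s => x (Fin.castLE t.isLt.le s)).prob ρ (x t)

/-- The probability of reaching the leaf `x` when a parameter `ω` is first drawn from `μ` and then
all `n` copies are in the state `σ ω`. -/
def LearningTree.mixtureLeafProb {ι : Type*} [Fintype ι] [DecidableEq ι] {n : ℕ}
    (T : LearningTree ι n) {Ω : Type*} [MeasurableSpace Ω] (μ : Measure Ω)
    (σ : Ω → Matrix ι ι ℂ) (x : T.Leaf) : ℝ :=
  ∫ ω, T.leafProb (σ ω) x ∂μ

/-- `H₀ : ρ = ρ₀` can be distinguished from `H₁ : ρ = σ ω` with `ω ∼ μ` with success probability at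
least `p` by some algorithm that makes `n` incoherent, possibly adaptive, measurements: at each
leaf the algorithm answers `false` (for `H₀`) or `true` (for `H₁`), and under either hypothesis
the answer is right with probability at least `p`. -/
def CanDistinguish {ι : Type*} [Fintype ι] [DecidableEq ι] {Ω : Type*} [MeasurableSpace Ω]
    (ρ₀ : Matrix ι ι ℂ) (μ : Measure Ω) (σ : Ω → Matrix ι ι ℂ) (p : ℝ) (n : ℕ) : Prop :=
  ∃ (T : LearningTree ι n) (answer : T.Leaf → Bool),
    p ≤ ∑ x with answer x = false, T.leafProb ρ₀ x ∧
    p ≤ ∑ x with answer x = true, T.mixtureLeafProb μ σ x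

/-- The law of the real `d₁ × d₂` Ginibre matrix: i.i.d. entries of law `N(0, 1/d₁)`. -/
def ginibre (d₁ d₂ : ℕ) : Measure (Fin d₁ → Fin d₂ → ℝ) :=
  Measure.pi fun _ => Measure.pi fun _ => gaussianReal 0 (1 / (d₁ : NNReal))

open scoped Matrix.Norms.L2Operator in
/-- The truncation event: the operator norm (the largest singular value) is at most `3`, and the
square of the Frobenius norm is at least `d₂ / 2`. -/
def ginibreEvent (d₁ d₂ : ℕ) : Set (Fin d₁ → Fin d₂ → ℝ) :=
  {G | ‖Matrix.of G‖ ≤ 3 ∧ (d₂ : ℝ) / 2 ≤ ∑ i, ∑ j, G i j ^ 2}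

/-- The law of the truncated Ginibre matrix: the Ginibre law conditioned on `ginibreEvent`. -/
def truncatedGinibre (d₁ d₂ : ℕ) : Measure (Fin d₁ → Fin d₂ → ℝ) :=
  ProbabilityTheory.cond (ginibre d₁ d₂) (ginibreEvent d₁ d₂)

/-- The null hypothesis: the block matrix with diagonal blocks `diag α` and `diag β`. -/
def nullState {d₁ d₂ : ℕ} (α : Fin d₁ → ℝ) (β : Fin d₂ → ℝ) :
    Matrix (Fin d₁ ⊕ Fin d₂) (Fin d₁ ⊕ Fin d₂) ℂ :=
  Matrix.fromBlocks
    (Matrix.diagonal fun i => (α i : ℂ)) 0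
    0 (Matrix.diagonal fun j => (β j : ℂ))

/-- The alternative: the diagonal blocks are as in `nullState`, the off-diagonal blocks are
`(ε / d₂) G` and its adjoint. -/
def altState {d₁ d₂ : ℕ} (α : Fin d₁ → ℝ) (β : Fin d₂ → ℝ) (ε : ℝ)
    (G : Fin d₁ → Fin d₂ → ℝ) :
    Matrix (Fin d₁ ⊕ Fin d₂) (Fin d₁ ⊕ Fin d₂) ℂ :=
  Matrix.fromBlocks
    (Matrix.diagonal fun i => (α i : ℂ))
    (((ε / d₂ : ℝ) : ℂ) • (Matrix.of G).map Complex.ofReal)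
    (((ε / d₂ : ℝ) : ℂ) • (Matrix.of G).map Complex.ofReal)ᴴ
    (Matrix.diagonal fun j => (β j : ℂ))

end

/-! The probability of an outcome under `H₁` is its probability under `H₀` times `1 + ⟨K, G⟩`, with
a score matrix `K` that depends only on the POVM element. The likelihood ratio of a leaf is
therefore the mean over `G` of `∏ (1 + ⟨K_t, G⟩)`. A Hellinger-type argument (`sq_le_of_test`) shows
that a test with success probability `p` forces `(2p - 1)² ≤ δ` as soon as the log-likelihood ratio
has a minorant of mean at least `-δ` under `H₀`.

The minorant comes from shifting the Gaussian by a matrix `H` chosen from the leaf (Cameron-Martin)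
and applying Jensen (`exp_logLikelihood_le`). Up to small errors it is `∑ ⟨K_t, H⟩ - d₁‖H‖²/2 - ∑
‖K_t‖²/(2d₁) - ∑ ⟨K_t, H⟩²`. For `H = S/d₁` with `S = ∑ K_t`, the first two terms give `‖S‖²/(2d₁)`.
Under `H₀` the sum `S` is a martingale, so `‖S‖²` and `∑ ‖K_t‖²` have the same mean and the leading
terms cancel. Only orthogonality of martingale increments enters, so adaptivity does no harm
(`treeMean_logLikelihood_ge`).

The shifted matrix must stay in the truncation event. Hence `S` is stopped once its norm exceeds
`d₁/20`, and the integral is restricted to a slightly smaller event of probability at least `1 -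
1/d₁` (`exists_forall_coreEvent_ge`).

Positivity of the POVM elements bounds the conditional covariance of the score in every direction by
`q = 4ε²/(d₂²b)`, and its mean squared norm by `q d₁`, although the matrices live in dimension
`d₁d₂`. What survives the cancellation has order `(nq)²/d₁ + nq/√d₁ + 1/d₁`. The trace condition
gives `q ≤ 16ε²/d₂`, so all of this is small unless `n` is of order `√d₁ d₂/ε²`. -/

/-! ### Gaussian moments, product measures and the Cameron-Martin formula. -/

section GaussianFacts

open scoped ENNReal NNReal Nat

/-- Tonelli's theorem for a product of functions of the separate coordinates. -/
lemma lintegral_pi_prod {ι : Type*} [Fintype ι] {X : ι → Type*} [∀ i, MeasurableSpace (X i)]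
    (μ : ∀ i, Measure (X i)) [∀ i, IsProbabilityMeasure (μ i)] (f : ∀ i, X i → ℝ≥0∞)
    (hf : ∀ i, Measurable (f i)) :
    ∫⁻ x, ∏ i, f i (x i) ∂(Measure.pi μ) = ∏ i, ∫⁻ x, f i x ∂(μ i) := by
  classical
  have h := lintegral_prod_eq_prod_lintegral_of_indepFun Finset.univ
    (fun i (x : ∀ i, X i) => f i (x i))
    (iIndepFun_pi (μ := μ) (X := f) fun i => (hf i).aemeasurable)
    (fun i => (hf i).comp (measurable_pi_apply i))
  rw [h]
  refine Finset.prod_congr rfl fun i _ => ?_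
  rw [← lintegral_map (hf i) (measurable_pi_apply i), Measure.pi_map_eval]
  simp

/-- A sum of functions of the separate coordinates that have centred Gaussian laws is Gaussian. -/
lemma map_sum_pi_gaussianReal {ι : Type*} [Fintype ι] {X : ι → Type*} [∀ i, MeasurableSpace (X i)]
    (μ : ∀ i, Measure (X i)) [∀ i, IsProbabilityMeasure (μ i)] (f : ∀ i, X i → ℝ)
    (hf : ∀ i, Measurable (f i)) (v : ι → ℝ≥0)
    (h : ∀ i, (μ i).map (f i) = gaussianReal 0 (v i)) :
    (Measure.pi μ).map (fun x => ∑ i, f i (x i)) = gaussianReal 0 (∑ i, v i) := by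
  classical
  have hm : ∀ i, Measurable fun x : ∀ i, X i => f i (x i) :=
    fun i => (hf i).comp (measurable_pi_apply i)
  have : IsProbabilityMeasure ((Measure.pi μ).map (fun x => ∑ i, f i (x i))) :=
    Measure.isProbabilityMeasure_map (Finset.measurable_fun_sum _ fun i _ => hm i).aemeasurable
  refine Measure.ext_of_charFun (funext fun t => ?_)
  have hi := iIndepFun_pi (μ := μ) (X := f) fun i => (hf i).aemeasurable
  have := congrFun (iIndepFun.charFun_map_fun_sum_eq_prod (fun i => (hm i).aemeasurable) hi) t
  rw [this, Finset.prod_apply, charFun_gaussianReal]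
  have h2 : ∀ i, (Measure.pi μ).map (fun x : ∀ i, X i => f i (x i)) = gaussianReal 0 (v i) := by
    intro i
    rw [← h i, ← Function.comp_def, ← Measure.map_map (hf i) (measurable_pi_apply i)]
    congr 1
    rw [Measure.pi_map_eval]; simp
  simp_rw [h2, charFun_gaussianReal]
  rw [← Complex.exp_sum]
  congr 1
  push_cast
  simp [Finset.sum_neg_distrib, Finset.sum_mul, Finset.sum_div]

/-- The law of a linear functional of a vector with i.i.d. centred Gaussian entries. -/
lemma map_linear_pi_gaussianReal {ι : Type*} [Fintype ι] (v : ℝ≥0) (c : ι → ℝ) :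
    (Measure.pi fun _ : ι => gaussianReal 0 v).map (fun x => ∑ i, c i * x i)
      = gaussianReal 0 (∑ i, NNReal.mk (c i ^ 2) (sq_nonneg _) * v) :=
  map_sum_pi_gaussianReal _ (fun i x => c i * x) (by fun_prop) _ fun i => by
    rw [gaussianReal_map_const_mul]; simp

/-- The even moments of a centred Gaussian. -/
lemma integral_pow_gaussianReal (v : ℝ≥0) (hv : v ≠ 0) (m : ℕ) :
    ∫ x, x ^ (2 * m) ∂(gaussianReal 0 v) = (v : ℝ) ^ m * ((2 * m - 1 : ℕ)‼ : ℝ) := by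
  have hv' : (0 : ℝ) < v := by positivity
  rw [integral_gaussianReal_eq_integral_smul hv]
  -- The integrand is even; as a function of `|x|` it reduces to a Gamma integral over the
  -- half-line.
  have h1 : ∀ x : ℝ, gaussianPDFReal 0 v x • x ^ (2 * m)
      = (fun y : ℝ => (√(2 * Real.pi * v))⁻¹ * (y ^ ((2 * m : ℕ) : ℝ)
        * Real.exp (-(2 * v : ℝ)⁻¹ * y ^ (2 : ℝ)))) |x| := by
    intro x
    simp only [gaussianPDFReal, smul_eq_mul, Real.rpow_natCast]
    rw [Real.rpow_two, sq_abs, pow_mul, pow_mul, sq_abs]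
    rw [sub_zero, mul_assoc, mul_comm (Real.exp _)]
    congr 3
    field_simp
  rw [integral_congr_ae (Filter.Eventually.of_forall h1)]
  refine (integral_comp_abs (f := fun y : ℝ => (√(2 * Real.pi * v))⁻¹ * (y ^ ((2 * m : ℕ) : ℝ)
        * Real.exp (-(2 * v : ℝ)⁻¹ * y ^ (2 : ℝ))))).trans ?_
  rw [integral_const_mul,
    integral_rpow_mul_exp_neg_mul_rpow (by norm_num)
      (lt_of_lt_of_le (by norm_num) (Nat.cast_nonneg _)) (by positivity)]
  have h2 : (((2 * m : ℕ) : ℝ) + 1) / 2 = m + 1 / 2 := by push_cast; ring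
  have h3 : -(((2 * m : ℕ) : ℝ) + 1) / 2 = -(m + 1 / 2) := by push_cast; ring
  rw [h2, h3, Real.Gamma_nat_add_half, Real.rpow_neg (by positivity), Real.inv_rpow (by positivity),
    inv_inv, Real.rpow_add (by positivity), Real.rpow_natCast, ← Real.sqrt_eq_rpow]
  have h4 : √(2 * Real.pi * v) = √Real.pi * √(2 * v) := by
    rw [← Real.sqrt_mul (by positivity)]; congr 1; ring
  rw [h4]
  have : 0 < √(2 * (v : ℝ)) := by positivity
  have : 0 < √Real.pi := by positivity
  rw [mul_pow]
  field_simp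

/-- The Gaussian moment generating function of a square. -/
lemma lintegral_exp_sq_gaussianReal (v : ℝ≥0) (hv : v ≠ 0) (s : ℝ) (hs : 2 * s * v < 1) :
    ∫⁻ x, ENNReal.ofReal (Real.exp (s * x ^ 2)) ∂(gaussianReal 0 v)
      = ENNReal.ofReal (√(1 - 2 * s * v))⁻¹ := by
  have hv' : (0 : ℝ) < v := by positivity
  have hb : 0 < (1 - 2 * s * v) / (2 * v) := div_pos (by linarith) (by positivity)
  rw [gaussianReal_of_var_ne_zero _ hv, lintegral_withDensity_eq_lintegral_mul _
    (measurable_gaussianPDF _ _) (by fun_prop)]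
  have h1 : ∀ x : ℝ, (gaussianPDF 0 v * fun x => ENNReal.ofReal (Real.exp (s * x ^ 2))) x
      = ENNReal.ofReal ((√(2 * Real.pi * v))⁻¹ *
        Real.exp (-((1 - 2 * s * v) / (2 * v)) * x ^ 2)) := by
    intro x
    rw [Pi.mul_apply, gaussianPDF, ← ENNReal.ofReal_mul (gaussianPDFReal_nonneg _ _ _),
      gaussianPDFReal, mul_assoc, ← Real.exp_add]
    congr 3
    field_simp
    ring
  simp_rw [h1]
  rw [← ofReal_integral_eq_lintegral_ofReal ((integrable_exp_neg_mul_sq hb).const_mul _)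
    (Filter.Eventually.of_forall fun x => by positivity), integral_const_mul, integral_gaussian]
  congr 1
  have : Real.pi / ((1 - 2 * s * v) / (2 * v)) = (2 * Real.pi * v) / (1 - 2 * s * v) := by
    field_simp
  rw [this, Real.sqrt_div (by positivity), inv_mul_eq_div, div_div_cancel_left' (by positivity)]

/-- The density of a shifted centred Gaussian. -/
lemma map_add_gaussianReal (v : ℝ≥0) (hv : v ≠ 0) (h : ℝ) :
    (gaussianReal 0 v).map (fun x => x + h) = (gaussianReal 0 v).withDensity
      (fun x => ENNReal.ofReal (Real.exp (h * x / v - h ^ 2 / (2 * v)))) := by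
  have hv' : (0 : ℝ) < v := by positivity
  rw [gaussianReal_map_add_const, zero_add, gaussianReal_of_var_ne_zero _ hv,
    gaussianReal_of_var_ne_zero _ hv,
    ← withDensity_mul _ (measurable_gaussianPDF _ _) (by fun_prop)]
  congr 1
  funext x
  rw [Pi.mul_apply, gaussianPDF, gaussianPDF, ← ENNReal.ofReal_mul (gaussianPDFReal_nonneg _ _ _),
      gaussianPDFReal, gaussianPDFReal, mul_assoc (√(2 * Real.pi * v))⁻¹, ← Real.exp_add]
  congr 3
  field_simp
  ring

/-- Densities of coordinatewise images of a product measure multiply. -/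
lemma map_pi_eq_withDensity {ι : Type*} [Fintype ι] {X : ι → Type*} [∀ i, MeasurableSpace (X i)]
    (μ : ∀ i, Measure (X i)) [∀ i, IsProbabilityMeasure (μ i)] (f : ∀ i, X i → X i)
    (hf : ∀ i, Measurable (f i)) (ρ : ∀ i, X i → ℝ≥0∞) (hρ : ∀ i, Measurable (ρ i))
    (h : ∀ i, (μ i).map (f i) = (μ i).withDensity (ρ i)) :
    (Measure.pi μ).map (fun x i => f i (x i))
      = (Measure.pi μ).withDensity (fun x => ∏ i, ρ i (x i)) := by
  have hp : ∀ i, IsProbabilityMeasure ((μ i).map (f i)) :=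
    fun i => Measure.isProbabilityMeasure_map (hf i).aemeasurable
  rw [Measure.pi_map_pi fun i => (hf i).aemeasurable]
  refine Measure.pi_eq fun s hs => ?_
  have hind : ∀ x : ∀ i, X i, (Set.univ.pi s).indicator (fun x => ∏ i, ρ i (x i)) x
      = ∏ i, (s i).indicator (ρ i) (x i) := by
    intro x
    by_cases hx : x ∈ Set.univ.pi s
    · rw [Set.indicator_of_mem hx]
      exact Finset.prod_congr rfl fun i _ => (Set.indicator_of_mem (hx i trivial) _).symm
    · rw [Set.indicator_of_notMem hx]
      simp only [Set.mem_pi, Set.mem_univ, true_implies, not_forall] at hx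
      obtain ⟨i, hi⟩ := hx
      exact (Finset.prod_eq_zero (Finset.mem_univ i) (Set.indicator_of_notMem hi _)).symm
  rw [withDensity_apply _ (MeasurableSet.univ_pi hs),
    ← lintegral_indicator (MeasurableSet.univ_pi hs)]
  simp_rw [hind]
  rw [lintegral_pi_prod _ _ fun i => (hρ i).indicator (hs i)]
  refine Finset.prod_congr rfl fun i _ => ?_
  rw [h i, withDensity_apply _ (hs i), lintegral_indicator (hs i)]

/-- The Frobenius inner product. -/
def frobInner {m n : Type*} [Fintype m] [Fintype n] (K G : m → n → ℝ) : ℝ :=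
  ∑ i, ∑ j, K i j * G i j

instance (d₁ d₂ : ℕ) : IsProbabilityMeasure (ginibre d₁ d₂) := by
  unfold ginibre; infer_instance

/-- The law of a linear functional of a Ginibre matrix. -/
lemma map_frobInner_ginibre {d₁ d₂ : ℕ} (K : Fin d₁ → Fin d₂ → ℝ) :
    (ginibre d₁ d₂).map (frobInner K)
      = gaussianReal 0 (Real.toNNReal (frobInner K K / d₁)) := by
  have := map_sum_pi_gaussianReal (fun _ : Fin d₁ => Measure.pi fun _ : Fin d₂ =>
    gaussianReal 0 (1 / (d₁ : NNReal))) (fun i x => ∑ j, K i j * x j) (by fun_prop) _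
    (fun i => map_linear_pi_gaussianReal (1 / (d₁ : NNReal)) (K i))
  unfold ginibre
  change Measure.map (fun G : Fin d₁ → Fin d₂ → ℝ => ∑ i, ∑ j, K i j * G i j) _ = _
  rw [this]
  congr 1
  apply NNReal.eq
  rw [Real.coe_toNNReal _ (by unfold frobInner; exact div_nonneg (Finset.sum_nonneg fun i _ =>
    Finset.sum_nonneg fun j _ => mul_self_nonneg _) (Nat.cast_nonneg _))]
  simp [frobInner, ← Finset.sum_mul, div_eq_mul_inv, pow_two]

/-- The Cameron-Martin formula for the Ginibre law. -/
lemma map_add_ginibre {d₁ d₂ : ℕ} (hd : 0 < d₁) (H : Fin d₁ → Fin d₂ → ℝ) :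
    (ginibre d₁ d₂).map (fun G => G + H) = (ginibre d₁ d₂).withDensity
      (fun G => ENNReal.ofReal (Real.exp (d₁ * frobInner H G - d₁ * frobInner H H / 2))) := by
  have hd' : (d₁ : ℝ) ≠ 0 := by positivity
  have hv : (1 / (d₁ : ℝ≥0)) ≠ 0 := by positivity
  have h := map_pi_eq_withDensity (fun _ : Fin d₁ => Measure.pi fun _ : Fin d₂ =>
    gaussianReal 0 (1 / (d₁ : NNReal))) (fun i x j => x j + H i j) (by fun_prop)
    _ (by fun_prop) fun i => map_pi_eq_withDensity (fun _ : Fin d₂ =>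
    gaussianReal 0 (1 / (d₁ : NNReal))) (fun j x => x + H i j) (by fun_prop) _ (by fun_prop)
    fun j => map_add_gaussianReal _ hv (H i j)
  refine Eq.trans h ?_
  unfold ginibre
  congr 1
  funext G
  simp_rw [← ENNReal.ofReal_prod_of_nonneg fun i _ => (Real.exp_pos _).le]
  rw [← ENNReal.ofReal_prod_of_nonneg fun i _ => by positivity]
  simp_rw [← Real.exp_sum]
  congr 2
  simp only [frobInner, Finset.mul_sum, Finset.sum_div, ← Finset.sum_sub_distrib]
  refine Finset.sum_congr rfl fun i _ => Finset.sum_congr rfl fun j _ => ?_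
  push_cast
  field_simp

end GaussianFacts

/-! ### The operator norm through bilinear forms. -/

section OperatorNorm

open scoped Matrix.Norms.L2Operator

variable {m n : Type*} [Fintype m] [Fintype n] [DecidableEq n]

lemma bilin_le_opNorm (G : m → n → ℝ) (u : m → ℝ) (v : n → ℝ) :
    ∑ i, ∑ j, u i * G i j * v j ≤ ‖Matrix.of G‖ * (√(∑ i, u i ^ 2) * √(∑ j, v j ^ 2)) := by
  have h1 := Matrix.l2_opNorm_mulVec (Matrix.of G) (WithLp.toLp 2 v)
  have h2 := real_inner_le_norm (WithLp.toLp 2 u) (WithLp.toLp 2 (Matrix.of G *ᵥ v))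
  have h3 : inner ℝ (WithLp.toLp 2 u) (WithLp.toLp 2 (Matrix.of G *ᵥ v))
      = ∑ i, ∑ j, u i * G i j * v j := by
    simp [PiLp.inner_apply, Matrix.mulVec, dotProduct, Finset.sum_mul]
    exact Finset.sum_congr rfl fun i _ => Finset.sum_congr rfl fun j _ => by ring
  have h4 : ‖WithLp.toLp 2 u‖ = √(∑ i, u i ^ 2) := by simp [EuclideanSpace.norm_eq]
  have h5 : ‖WithLp.toLp 2 v‖ = √(∑ i, v i ^ 2) := by simp [EuclideanSpace.norm_eq]
  rw [h3] at h2
  rw [h5] at h1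
  calc _ ≤ _ := h2
    _ ≤ √(∑ i, u i ^ 2) * (‖Matrix.of G‖ * √(∑ j, v j ^ 2)) := by
      rw [h4]; exact mul_le_mul_of_nonneg_left h1 (Real.sqrt_nonneg _)
    _ = _ := by ring

/-- Taking `u = G v` turns the hypothesis into `‖G v‖² ≤ s ‖G v‖ ‖v‖`, and one factor cancels. -/
lemma opNorm_le_of_bilin_le (G : m → n → ℝ) {s : ℝ} (hs : 0 ≤ s)
    (h : ∀ (u : m → ℝ) (v : n → ℝ), ∑ i, ∑ j, u i * G i j * v j ≤ s * (√(∑ i, u i ^ 2) * √(∑ j, v j ^ 2))) :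
    ‖Matrix.of G‖ ≤ s := by
  rw [Matrix.l2_opNorm_def]
  refine ContinuousLinearMap.opNorm_le_bound _ hs fun x => ?_
  set v : n → ℝ := WithLp.ofLp x
  set w : m → ℝ := Matrix.of G *ᵥ v
  have hw := h w v
  have h3 : ∑ i, ∑ j, w i * G i j * v j = ∑ i, w i ^ 2 := by
    refine Finset.sum_congr rfl fun i _ => ?_
    have : w i = ∑ j, G i j * v j := rfl
    conv_rhs => rw [pow_two]; rhs; rw [this]
    rw [Finset.mul_sum]
    exact Finset.sum_congr rfl fun j _ => by ring
  have h4 : ‖(Matrix.toEuclideanLin (𝕜 := ℝ) (Matrix.of G)) x‖ = √(∑ i, w i ^ 2) := by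
    rw [EuclideanSpace.norm_eq]; simp [w, v, Matrix.toLpLin_apply]
  have h5 : ‖x‖ = √(∑ i, v i ^ 2) := by simp [EuclideanSpace.norm_eq, v]
  change ‖(Matrix.toEuclideanLin (𝕜 := ℝ) (Matrix.of G)) x‖ ≤ s * ‖x‖
  rw [h4, h5]
  rw [h3] at hw
  by_cases h0 : √(∑ i, w i ^ 2) = 0
  · rw [h0]; positivity
  · have hpos : 0 < √(∑ i, w i ^ 2) := lt_of_le_of_ne (Real.sqrt_nonneg _) (Ne.symm h0)
    have h6 : ∑ i, w i ^ 2 = √(∑ i, w i ^ 2) * √(∑ i, w i ^ 2) :=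
      (Real.mul_self_sqrt (Finset.sum_nonneg fun i _ => sq_nonneg _)).symm
    refine le_of_mul_le_mul_left ?_ hpos
    rw [← h6]
    linarith

lemma continuous_opNorm_of : Continuous fun G : m → n → ℝ => ‖Matrix.of G‖ :=
  continuous_norm.comp continuous_id

/-- A matrix of operator norm more than `s` has adjoint expanding some unit vector by `s`. -/
lemma exists_unit_of_lt_opNorm (G : m → n → ℝ) {s : ℝ} (hs : 0 ≤ s) (h : s < ‖Matrix.of G‖) :
    ∃ u : m → ℝ, ∑ i, u i ^ 2 = 1 ∧ s ^ 2 ≤ ∑ j, (∑ i, u i * G i j) ^ 2 := by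
  by_contra! hc
  refine absurd (opNorm_le_of_bilin_le G hs fun u v => ?_) (not_le.mpr h)
  have hnn : 0 ≤ ∑ i, u i ^ 2 := Finset.sum_nonneg fun i _ => sq_nonneg _
  rcases hnn.eq_or_lt with h0 | hpos
  · have hu : ∀ i, u i = 0 := fun i => by
      have := (Finset.sum_eq_zero_iff_of_nonneg fun i _ => sq_nonneg (u i)).mp h0.symm i
        (Finset.mem_univ i)
      simpa using this
    simp only [hu]; simp
  · set r := √(∑ i, u i ^ 2) with hr
    have hrpos : 0 < r := Real.sqrt_pos.mpr hpos
    have hr2 : r ^ 2 = ∑ i, u i ^ 2 := Real.sq_sqrt hnn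
    have h1 := hc (fun i => u i / r) (by
      simp_rw [div_pow, ← Finset.sum_div, hr2]; exact div_self hpos.ne')
    have h2 : ∑ j, (∑ i, u i * G i j) ^ 2 ≤ (s * r) ^ 2 := by
      have : ∑ j, (∑ i, u i * G i j) ^ 2 = r ^ 2 * ∑ j, (∑ i, u i / r * G i j) ^ 2 := by
        rw [Finset.mul_sum]
        refine Finset.sum_congr rfl fun j _ => ?_
        rw [← mul_pow, Finset.mul_sum]
        congr 1
        exact Finset.sum_congr rfl fun i _ => by field_simp
      rw [this, mul_pow, mul_comm]
      exact mul_le_mul_of_nonneg_right h1.le (sq_nonneg _)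
    calc ∑ i, ∑ j, u i * G i j * v j = ∑ j, (∑ i, u i * G i j) * v j := by
          rw [Finset.sum_comm]; simp_rw [Finset.sum_mul]
      _ ≤ √(∑ j, (∑ i, u i * G i j) ^ 2) * √(∑ j, v j ^ 2) :=
          Real.sum_mul_le_sqrt_mul_sqrt _ _ _
      _ ≤ (s * r) * √(∑ j, v j ^ 2) := by
          gcongr; exact Real.sqrt_le_iff.mpr ⟨by positivity, h2⟩
      _ = s * (r * √(∑ j, v j ^ 2)) := by ring

lemma opNorm_le_frob (G : m → n → ℝ) : ‖Matrix.of G‖ ≤ √(frobInner G G) := by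
  refine opNorm_le_of_bilin_le G (Real.sqrt_nonneg _) fun u v => ?_
  have h1 : ∑ i, ∑ j, u i * G i j * v j = ∑ p : m × n, G p.1 p.2 * (u p.1 * v p.2) := by
    rw [Fintype.sum_prod_type]
    exact Finset.sum_congr rfl fun i _ => Finset.sum_congr rfl fun j _ => by ring
  have h2 : (∑ i, u i ^ 2) * (∑ j, v j ^ 2) = ∑ p : m × n, (u p.1 * v p.2) ^ 2 := by
    rw [Fintype.sum_prod_type, Finset.sum_mul_sum]
    simp_rw [mul_pow]
  have h3 : frobInner G G = ∑ p : m × n, G p.1 p.2 ^ 2 := by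
    rw [Fintype.sum_prod_type]; simp [frobInner, pow_two]
  rw [h1, ← Real.sqrt_mul (Finset.sum_nonneg fun i _ => sq_nonneg _), h2, h3]
  exact Real.sum_mul_le_sqrt_mul_sqrt _ _ _

end OperatorNorm

/-! ### Tails of the operator norm and the Frobenius norm of a Ginibre matrix. -/

section OperatorNormTail

open scoped ENNReal NNReal Nat

lemma pow_le_factorial_mul_exp {y : ℝ} (hy : 0 ≤ y) (k : ℕ) :
    y ^ k ≤ k ! * 3 ^ k * Real.exp (3⁻¹ * y) := by
  have h := Real.pow_div_factorial_le_exp (3⁻¹ * y) (by positivity) k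
  rw [div_le_iff₀ (by positivity), mul_pow] at h
  calc y ^ k = 3 ^ k * (3⁻¹ ^ k * y ^ k) := by rw [← mul_assoc, ← mul_pow]; norm_num
    _ ≤ 3 ^ k * (Real.exp (3⁻¹ * y) * k !) := by gcongr
    _ = _ := by ring

/-- A power is dominated by an exponential, whose mean factorises over the coordinates. The rate
`1/(3v)` gives each coordinate the factor `(1 - 2/3)^(-1/2) = √3`. -/
lemma lintegral_sum_sq_pow_le {ι X : Type*} [Fintype ι] [MeasurableSpace X]
    (μ : Measure X) [IsProbabilityMeasure μ] (f : X → ℝ) (hf : Measurable f) (v : ℝ≥0)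
    (h : μ.map f = gaussianReal 0 v) (k : ℕ) (hk : k ≠ 0) :
    ∫⁻ x, ENNReal.ofReal ((∑ i, f (x i) ^ 2) ^ k) ∂(Measure.pi fun _ : ι => μ)
      ≤ ENNReal.ofReal (v ^ k * (k ! * 3 ^ k * √3 ^ Fintype.card ι)) := by
  rcases eq_or_ne v 0 with rfl | hv
  · have h0 : ∀ᵐ x ∂μ, f x = 0 := by
      have : ∀ᵐ y ∂(μ.map f), y = 0 := by
        rw [h, gaussianReal_zero_var]; simp [ae_dirac_eq]
      exact ae_of_ae_map hf.aemeasurable this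
    have h1 : ∀ᵐ x ∂(Measure.pi fun _ : ι => μ), ∀ i, f (x i) = 0 :=
      ae_all_iff.mpr fun i => 
      (Measure.quasiMeasurePreserving_eval (fun _ : ι => μ) i).ae (p := fun y => f y = 0) h0
    rw [lintegral_congr_ae (g := fun _ => 0) (h1.mono fun x hx => by simp [hx, hk])]
    simp
  · have hv' : (0 : ℝ) < v := by positivity
    have hpt : ∀ x : ι → X, ENNReal.ofReal ((∑ i, f (x i) ^ 2) ^ k)
        ≤ ENNReal.ofReal (v ^ k * (k ! * 3 ^ k)) *
          ∏ i, ENNReal.ofReal (Real.exp ((3 * v : ℝ)⁻¹ * f (x i) ^ 2)) := by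
      intro x
      rw [← ENNReal.ofReal_prod_of_nonneg fun i _ => (Real.exp_pos _).le,
        ← ENNReal.ofReal_mul (by positivity), ← Real.exp_sum, ← Finset.mul_sum]
      refine ENNReal.ofReal_le_ofReal ?_
      have := pow_le_factorial_mul_exp (y := (∑ i, f (x i) ^ 2) / v)
        (div_nonneg (Finset.sum_nonneg fun i _ => sq_nonneg _) hv'.le) k
      rw [div_pow, div_le_iff₀ (by positivity)] at this
      refine this.trans (le_of_eq ?_)
      have : (3 : ℝ)⁻¹ * ((∑ i, f (x i) ^ 2) / v) = (3 * v : ℝ)⁻¹ * ∑ i, f (x i) ^ 2 := by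
        field_simp
      rw [this]; ring
    refine (lintegral_mono hpt).trans ?_
    rw [lintegral_const_mul' _ _ ENNReal.ofReal_ne_top,
      lintegral_pi_prod _ (fun _ x => ENNReal.ofReal (Real.exp ((3 * v : ℝ)⁻¹ * f x ^ 2)))
        (by fun_prop)]
    have h2 : ∫⁻ x, ENNReal.ofReal (Real.exp ((3 * v : ℝ)⁻¹ * f x ^ 2)) ∂μ
        = ENNReal.ofReal √3 := by
      rw [← lintegral_map (f := fun y => ENNReal.ofReal (Real.exp ((3 * v : ℝ)⁻¹ * y ^ 2)))
        (by fun_prop) hf, h, lintegral_exp_sq_gaussianReal v hv]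
      · congr 1
        rw [← Real.sqrt_inv]; congr 1; field_simp; norm_num
      · field_simp; norm_num
    simp_rw [h2]
    rw [Finset.prod_const, ← ENNReal.ofReal_pow (by positivity),
      ← ENNReal.ofReal_mul (by positivity), Finset.card_univ, mul_assoc]

lemma lintegral_pow_linear_gaussianReal {d : ℕ} (w : Fin d → ℝ) (k : ℕ) (hw : 0 < ∑ j, w j ^ 2) :
    ∫⁻ g, ENNReal.ofReal ((∑ j, w j * g j) ^ (2 * k)) ∂(Measure.pi fun _ => gaussianReal 0 1)
      = ENNReal.ofReal ((∑ j, w j ^ 2) ^ k * ((2 * k - 1 : ℕ)‼ : ℝ)) := by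
  rw [← lintegral_map (f := fun y => ENNReal.ofReal (y ^ (2 * k))) (by fun_prop)
    (show Measurable fun g : Fin d → ℝ => ∑ j, w j * g j by fun_prop),
    map_linear_pi_gaussianReal]
  set V : ℝ≥0 := ∑ j, NNReal.mk (w j ^ 2) (sq_nonneg _) * 1 with hV
  have hV' : (V : ℝ) = ∑ j, w j ^ 2 := by simp [hV]
  have hV0 : V ≠ 0 := by
    intro h0; rw [h0] at hV'; simp only [NNReal.coe_zero] at hV'; linarith
  have hm := integral_pow_gaussianReal V hV0 k
  rw [← ofReal_integral_eq_lintegral_ofReal _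
    (Filter.Eventually.of_forall fun x => (even_two_mul k).pow_nonneg x), hm, hV']
  -- The Bochner integral of a non-integrable function is `0`, which contradicts the positive value
  -- of the moment.
  by_contra hni
  rw [integral_undef hni, hV'] at hm
  have : 0 < (∑ j, w j ^ 2) ^ k * ((2 * k - 1 : ℕ)‼ : ℝ) :=
    mul_pos (pow_pos hw _) (Nat.cast_pos.mpr (Nat.doubleFactorial_pos _))
  linarith

-- This replaces an ε-net. Test `G` on an independent standard Gaussian vector `g`. If `‖G‖ > s`,
-- some unit `u` makes `⟨u, G g⟩` Gaussian in `g` with variance at least `s²`, which bounds the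
-- `2d₁`-th moment of `‖G g‖` from below. Averaging over `G` first, the coordinates of `G g` are
-- i.i.d. Gaussians of variance `‖g‖²/d₁`, which bounds the same moment from above.
open scoped Matrix.Norms.L2Operator in
lemma ginibre_opNorm_moment {d₁ d₂ : ℕ} (hd₁ : 0 < d₁) (hd : d₂ ≤ d₁) (s : ℝ) (hs : 0 < s) :
    ginibre d₁ d₂ {G | s < ‖Matrix.of G‖} *
        ENNReal.ofReal ((s ^ 2) ^ d₁ * ((2 * d₁ - 1 : ℕ)‼ : ℝ))
      ≤ ENNReal.ofReal ((d₁ ! : ℝ) ^ 2 * 27 ^ d₁ / (d₁ : ℝ) ^ d₁) := by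
  set std : Measure (Fin d₂ → ℝ) := Measure.pi fun _ => gaussianReal 0 1
  set F : (Fin d₁ → Fin d₂ → ℝ) → (Fin d₂ → ℝ) → ℝ≥0∞ :=
    fun G g => ENNReal.ofReal ((∑ i, (∑ j, g j * G i j) ^ 2) ^ d₁) with hF
  have hFm : Measurable (Function.uncurry F) := by
    refine ENNReal.measurable_ofReal.comp (Continuous.measurable ?_)
    fun_prop
  have hlow : ∀ G ∈ {G : Fin d₁ → Fin d₂ → ℝ | s < ‖Matrix.of G‖},
      ENNReal.ofReal ((s ^ 2) ^ d₁ * ((2 * d₁ - 1 : ℕ)‼ : ℝ)) ≤ ∫⁻ g, F G g ∂std := by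
    intro G hG
    obtain ⟨u, hu, hw⟩ := exists_unit_of_lt_opNorm G hs.le hG
    refine le_trans ?_ (le_trans (lintegral_pow_linear_gaussianReal (fun j => ∑ i, u i * G i j) d₁
      (lt_of_lt_of_le (by positivity) hw)).ge (lintegral_mono fun g => ?_))
    · exact ENNReal.ofReal_le_ofReal (by gcongr)
    · refine ENNReal.ofReal_le_ofReal ?_
      rw [pow_mul]
      refine pow_le_pow_left₀ (sq_nonneg _) ?_ _
      have h1 : ∑ j, (∑ i, u i * G i j) * g j = ∑ i, u i * ∑ j, g j * G i j := by
        simp_rw [Finset.sum_mul, Finset.mul_sum]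
        rw [Finset.sum_comm]
        exact Finset.sum_congr rfl fun i _ => Finset.sum_congr rfl fun j _ => by ring
      rw [h1]
      refine (Finset.sum_mul_sq_le_sq_mul_sq _ _ _).trans ?_
      rw [hu, one_mul]
  have hset : MeasurableSet {G : Fin d₁ → Fin d₂ → ℝ | s < ‖Matrix.of G‖} :=
    (isOpen_lt continuous_const continuous_opNorm_of).measurableSet
  calc _ = ∫⁻ G in {G | s < ‖Matrix.of G‖},
          ENNReal.ofReal ((s ^ 2) ^ d₁ * ((2 * d₁ - 1 : ℕ)‼ : ℝ)) ∂(ginibre d₁ d₂) := by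
        rw [setLIntegral_const, mul_comm]
    _ ≤ ∫⁻ G in {G | s < ‖Matrix.of G‖}, ∫⁻ g, F G g ∂std ∂(ginibre d₁ d₂) :=
        setLIntegral_mono' hset hlow
    _ ≤ ∫⁻ G, ∫⁻ g, F G g ∂std ∂(ginibre d₁ d₂) := setLIntegral_le_lintegral _ _
    _ = ∫⁻ g, ∫⁻ G, F G g ∂(ginibre d₁ d₂) ∂std := lintegral_lintegral_swap hFm.aemeasurable
    _ ≤ ∫⁻ g, ENNReal.ofReal (((d₁ : ℝ)⁻¹ ^ d₁ * (d₁ ! * 3 ^ d₁ * √3 ^ d₁)))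
          * ENNReal.ofReal ((∑ j, g j ^ 2) ^ d₁) ∂std := by
        refine lintegral_mono fun g => ?_
        refine (lintegral_sum_sq_pow_le _ (fun x : Fin d₂ → ℝ => ∑ j, g j * x j) (by fun_prop) _
          (map_linear_pi_gaussianReal _ g) d₁ hd₁.ne').trans (le_of_eq ?_)
        rw [← ENNReal.ofReal_mul (by positivity)]
        congr 1
        simp only [Fintype.card_fin, NNReal.coe_sum, NNReal.coe_mul, NNReal.coe_mk,
          ← Finset.sum_mul]
        rw [mul_pow]
        simp only [one_div, NNReal.coe_inv, NNReal.coe_natCast]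
        ring
    _ ≤ ENNReal.ofReal (((d₁ : ℝ)⁻¹ ^ d₁ * (d₁ ! * 3 ^ d₁ * √3 ^ d₁)))
          * ENNReal.ofReal (d₁ ! * 3 ^ d₁ * √3 ^ d₁) := by
        rw [lintegral_const_mul' _ _ ENNReal.ofReal_ne_top]
        gcongr
        refine (lintegral_sum_sq_pow_le (gaussianReal 0 1) (fun x => x) measurable_id 1
          Measure.map_id d₁ hd₁.ne').trans (ENNReal.ofReal_le_ofReal ?_)
        simp only [Fintype.card_fin, NNReal.coe_one, one_pow, one_mul]
        gcongr
        exact Real.one_le_sqrt.mpr (by norm_num)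
    _ = _ := by
        rw [← ENNReal.ofReal_mul (by positivity)]
        congr 1
        have h3 : (√3 : ℝ) ^ d₁ * √3 ^ d₁ = 3 ^ d₁ := by rw [← mul_pow]; norm_num
        have h27 : (27 : ℝ) ^ d₁ = 3 ^ d₁ * 3 ^ d₁ * 3 ^ d₁ := by
          rw [← mul_pow, ← mul_pow]; norm_num
        rw [h27, inv_pow, div_eq_mul_inv]
        linear_combination ((d₁ : ℝ) ^ d₁)⁻¹ * (d₁ ! : ℝ) ^ 2 * 3 ^ d₁ * 3 ^ d₁ * h3

/-- The point is that the base `8` lies below `2.9² = 8.41`, so the moment bound decays at `s =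
2.9`. In the induction step `(1 + 1/m)^m ≥ 2` leaves `54(m + 1) ≤ 32(2m + 1)`, valid from `m = 3`
on. -/
lemma factorial_sq_mul_le (m : ℕ) (hm : 3 ≤ m) :
    (m ! : ℝ) ^ 2 * 27 ^ m ≤ 4 * 8 ^ m * m ^ m * ((2 * m - 1 : ℕ)‼ : ℝ) := by
  induction m, hm using Nat.le_induction with
  | base => norm_num [Nat.factorial, Nat.doubleFactorial]
  | succ m hm ih =>
    have h1 : 2 * (m + 1) - 1 = (2 * m - 1) + 2 := by omega
    have h2 : ((2 * m - 1 + 2 : ℕ) : ℝ) = 2 * m + 1 := by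
      have : 2 * m - 1 + 2 = 2 * m + 1 := by omega
      rw [this]; push_cast; ring
    rw [h1, Nat.doubleFactorial_add_two, Nat.cast_mul, h2, Nat.factorial_succ]
    push_cast
    have hm' : (3 : ℝ) ≤ m := by exact_mod_cast hm
    have hb : 2 * (m : ℝ) ^ m ≤ (m + 1) ^ m := by
      have := one_add_mul_le_pow (a := (1 / m : ℝ)) (by
        have : (0 : ℝ) ≤ 1 / m := by positivity
        linarith) m
      have h3 : (m + 1 : ℝ) ^ m = m ^ m * (1 + 1 / m) ^ m := by
        rw [← mul_pow]; congr 1; field_simp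
      rw [h3, mul_comm]
      gcongr
      refine le_trans (le_of_eq ?_) this
      field_simp; norm_num
    have hpos : (0 : ℝ) ≤ ((2 * m - 1 : ℕ)‼ : ℝ) := Nat.cast_nonneg _
    calc ((m + 1 : ℝ) * m !) ^ 2 * 27 ^ (m + 1)
        = 27 * (m + 1) ^ 2 * ((m ! : ℝ) ^ 2 * 27 ^ m) := by ring
      _ ≤ 27 * (m + 1) ^ 2 * (4 * 8 ^ m * m ^ m * ((2 * m - 1 : ℕ)‼ : ℝ)) := by gcongr
      _ = (54 * (m + 1) ^ 2 * (8 ^ m * ((2 * m - 1 : ℕ)‼ : ℝ))) * (2 * (m : ℝ) ^ m) := by ring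
      _ ≤ (54 * (m + 1) ^ 2 * (8 ^ m * ((2 * m - 1 : ℕ)‼ : ℝ))) * (m + 1) ^ m := by gcongr
      _ = (54 * (m + 1)) * (8 ^ m * ((2 * m - 1 : ℕ)‼ : ℝ) * (m + 1) ^ (m + 1)) := by ring
      _ ≤ (32 * (2 * m + 1)) * (8 ^ m * ((2 * m - 1 : ℕ)‼ : ℝ) * (m + 1) ^ (m + 1)) := by
          gcongr ?_ * _
          linarith
      _ = _ := by ring

open scoped Matrix.Norms.L2Operator in
lemma ginibre_opNorm_tail {d₁ d₂ : ℕ} (hd₁ : 3 ≤ d₁) (hd : d₂ ≤ d₁) :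
    (ginibre d₁ d₂).real {G | 29 / 10 < ‖Matrix.of G‖} ≤ 4 * (800 / 841) ^ d₁ := by
  have h := ginibre_opNorm_moment (by omega) hd (29 / 10) (by norm_num)
  have hf := factorial_sq_mul_le d₁ hd₁
  have hdf : (0 : ℝ) < ((2 * d₁ - 1 : ℕ)‼ : ℝ) := Nat.cast_pos.mpr (Nat.doubleFactorial_pos _)
  have hdd : (0 : ℝ) < (d₁ : ℝ) ^ d₁ := by
    have : 0 < d₁ := by omega
    positivity
  rw [← ENNReal.ofReal_toReal (measure_ne_top (ginibre d₁ d₂) _),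
    ← ENNReal.ofReal_mul ENNReal.toReal_nonneg, ENNReal.ofReal_le_ofReal_iff (by positivity)] at h
  change (ginibre d₁ d₂).real _ * _ ≤ _ at h
  rw [← le_div_iff₀ (by positivity)] at h
  refine h.trans ?_
  rw [div_le_iff₀ (by positivity), div_le_iff₀ hdd]
  refine hf.trans (le_of_eq ?_)
  have : (8 : ℝ) ^ d₁ = (800 / 841) ^ d₁ * ((29 / 10) ^ 2) ^ d₁ := by rw [← mul_pow]; norm_num
  rw [this]; ring

/-- A Chernoff bound with exponent `-d₁/10`: each entry contributes `1/√1.2` against the threshold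
`exp(-0.081)`, and `1.2 · exp(-0.162)` exceeds `1`. -/
lemma ginibre_frob_tail {d₁ d₂ : ℕ} (hd₁ : 0 < d₁) (hd₂ : 0 < d₂) :
    (ginibre d₁ d₂).real {G | frobInner G G < 81 / 100 * d₂} ≤ (√(999 / 1000)) ^ d₁ := by
  have hv : (1 / (d₁ : ℝ≥0)) ≠ 0 := by positivity
  have hd' : (0 : ℝ) < d₁ := by positivity
  set c : ℝ≥0∞ := ENNReal.ofReal (Real.exp (-(81 / 1000) * (d₁ * d₂)))
  have hlow : ∀ G ∈ {G : Fin d₁ → Fin d₂ → ℝ | frobInner G G < 81 / 100 * d₂},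
      c ≤ ∏ i, ∏ j, ENNReal.ofReal (Real.exp (-(d₁ / 10) * G i j ^ 2)) := by
    intro G hG
    simp_rw [← ENNReal.ofReal_prod_of_nonneg fun i _ => (Real.exp_pos _).le]
    rw [← ENNReal.ofReal_prod_of_nonneg fun i _ => by positivity]
    simp_rw [← Real.exp_sum, ← Finset.mul_sum]
    refine ENNReal.ofReal_le_ofReal (Real.exp_le_exp.mpr ?_)
    have : ∑ i, ∑ j, G i j ^ 2 = frobInner G G := by simp [frobInner, pow_two]
    rw [this]
    have hG' : frobInner G G < 81 / 100 * d₂ := hG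
    nlinarith
  have hset : MeasurableSet {G : Fin d₁ → Fin d₂ → ℝ | frobInner G G < 81 / 100 * d₂} := by
    refine (isOpen_lt ?_ continuous_const).measurableSet
    unfold frobInner; fun_prop
  have h : ginibre d₁ d₂ {G | frobInner G G < 81 / 100 * d₂} * c
      ≤ ENNReal.ofReal ((√(12 / 10))⁻¹ ^ (d₁ * d₂)) := by
    calc _ = ∫⁻ G in {G | frobInner G G < 81 / 100 * d₂}, c ∂(ginibre d₁ d₂) := by
          rw [setLIntegral_const, mul_comm]
      _ ≤ ∫⁻ G in {G | frobInner G G < 81 / 100 * d₂},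
            ∏ i, ∏ j, ENNReal.ofReal (Real.exp (-(d₁ / 10) * G i j ^ 2)) ∂(ginibre d₁ d₂) :=
          setLIntegral_mono' hset hlow
      _ ≤ ∫⁻ G, ∏ i, ∏ j, ENNReal.ofReal (Real.exp (-(d₁ / 10) * G i j ^ 2)) ∂(ginibre d₁ d₂) :=
          setLIntegral_le_lintegral _ _
      _ = _ := by
          unfold ginibre
          rw [lintegral_pi_prod (fun _ : Fin d₁ => Measure.pi fun _ : Fin d₂ =>
            gaussianReal 0 (1 / (d₁ : NNReal)))
            (fun _ x => ∏ j, ENNReal.ofReal (Real.exp (-(d₁ / 10) * x j ^ 2))) (by fun_prop)]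
          simp_rw [lintegral_pi_prod (fun _ : Fin d₂ => gaussianReal 0 (1 / (d₁ : NNReal)))
            (fun _ x => ENNReal.ofReal (Real.exp (-(d₁ / 10) * x ^ 2))) (by fun_prop)]
          have : (2 : ℝ) * (-(d₁ / 10)) * ((1 / (d₁ : ℝ≥0) : ℝ≥0) : ℝ) = -(2 / 10) := by
            push_cast; field_simp
          rw [lintegral_exp_sq_gaussianReal _ hv _ (by rw [this]; norm_num), this]
          simp only [Finset.prod_const, Finset.card_univ, Fintype.card_fin]
          rw [← pow_mul, ENNReal.ofReal_pow (by positivity), mul_comm d₂]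
          norm_num
  rw [← ENNReal.ofReal_toReal (measure_ne_top (ginibre d₁ d₂) _),
    ← ENNReal.ofReal_mul ENNReal.toReal_nonneg, ENNReal.ofReal_le_ofReal_iff (by positivity)] at h
  change (ginibre d₁ d₂).real _ * _ ≤ _ at h
  rw [← le_div_iff₀ (by positivity)] at h
  refine h.trans ?_
  have he : Real.exp (-(81 / 1000) * (d₁ * d₂)) = (√(Real.exp (-(162 / 1000)))) ^ (d₁ * d₂) := by
    rw [Real.sqrt_eq_rpow, ← Real.exp_mul, ← Real.exp_nat_mul]
    congr 1; push_cast; ring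
  rw [he, ← div_pow, ← Real.sqrt_inv, ← Real.sqrt_div' _ (Real.exp_pos _).le]
  have hr : √((12 / 10)⁻¹ / Real.exp (-(162 / 1000))) ≤ √(999 / 1000) := by
    refine Real.sqrt_le_sqrt ?_
    rw [div_le_iff₀ (Real.exp_pos _)]
    have := Real.add_one_le_exp (-(162 / 1000) : ℝ)
    linarith
  calc _ ≤ (√(999 / 1000)) ^ (d₁ * d₂) := by gcongr
    _ ≤ _ := pow_le_pow_of_le_one (Real.sqrt_nonneg _)
      (Real.sqrt_le_one.mpr (by norm_num)) (Nat.le_mul_of_pos_right _ hd₂)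

open scoped Matrix.Norms.L2Operator in
/-- A part of the truncation event that keeps a distance from its boundary. -/
def coreEvent (d₁ d₂ : ℕ) : Set (Fin d₁ → Fin d₂ → ℝ) :=
  {G | ‖Matrix.of G‖ ≤ 29 / 10 ∧ 81 / 100 * (d₂ : ℝ) ≤ frobInner G G}

lemma measurableSet_coreEvent (d₁ d₂ : ℕ) : MeasurableSet (coreEvent d₁ d₂) := by
  have h : Continuous fun G : Fin d₁ → Fin d₂ → ℝ => frobInner G G := by
    unfold frobInner; fun_prop
  exact (IsClosed.inter (isClosed_le continuous_opNorm_of (continuous_const (y := 29 / 10)))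
    (isClosed_le (continuous_const (y := 81 / 100 * (d₂ : ℝ))) h)).measurableSet

lemma measurableSet_ginibreEvent (d₁ d₂ : ℕ) : MeasurableSet (ginibreEvent d₁ d₂) := by
  have h : Continuous fun G : Fin d₁ → Fin d₂ → ℝ => ∑ i, ∑ j, G i j ^ 2 := by fun_prop
  exact (IsClosed.inter (isClosed_le continuous_opNorm_of (continuous_const (y := 3)))
    (isClosed_le (continuous_const (y := (d₂ : ℝ) / 2)) h)).measurableSet

/-- The core event is typical. -/
lemma exists_forall_coreEvent_ge : ∃ D : ℕ, ∀ d₁ d₂ : ℕ, D ≤ d₁ → 0 < d₂ → d₂ ≤ d₁ →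
    1 - 1 / (d₁ : ℝ) ≤ (ginibre d₁ d₂).real (coreEvent d₁ d₂) := by
  have t1 := tendsto_pow_const_mul_const_pow_of_abs_lt_one 1 (r := 800 / 841)
    (by rw [abs_of_pos] <;> norm_num)
  have t2 := tendsto_pow_const_mul_const_pow_of_abs_lt_one 1 (r := √(999 / 1000))
    (by rw [abs_of_nonneg (Real.sqrt_nonneg _), Real.sqrt_lt' (by norm_num)]; norm_num)
  have t3 := (t1.const_mul 4).add t2
  simp only [mul_zero, add_zero, pow_one] at t3
  obtain ⟨D, hD⟩ := Filter.eventually_atTop.mp (t3.eventually (gt_mem_nhds one_pos))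
  refine ⟨max D 3, fun d₁ d₂ hd₁ hd₂ hd => ?_⟩
  have h3 : 3 ≤ d₁ := le_trans (le_max_right _ _) hd₁
  have hpos : (0 : ℝ) < d₁ := by positivity
  have h1 := ginibre_opNorm_tail h3 hd
  have h2 := ginibre_frob_tail (by omega : 0 < d₁) hd₂
  have hc : (ginibre d₁ d₂).real (coreEvent d₁ d₂)ᶜ ≤ 1 / d₁ := by
    refine (measureReal_mono (s₂ := _ ∪ _) (fun G hG => ?_) (measure_ne_top _ _)).trans
      ((measureReal_union_le _ _).trans ((add_le_add h1 h2).trans ?_))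
    · by_contra h
      simp only [Set.mem_union, Set.mem_ofPred_eq, not_or, not_lt] at h
      exact hG h
    · rw [le_div_iff₀ hpos]
      have := hD d₁ (le_trans (le_max_left _ _) hd₁)
      linarith
  rw [probReal_compl_eq_one_sub (measurableSet_coreEvent d₁ d₂)] at hc
  linarith

end OperatorNormTail

/-! ### Cauchy-Schwarz inequalities for the blocks of a positive semidefinite matrix. -/

section PositiveBlocks

variable {m n : Type*} [Fintype m] [Fintype n]

/-- The real part of the upper right block of a block matrix. -/
def offDiagRe (M : Matrix (m ⊕ n) (m ⊕ n) ℂ) : m → n → ℝ :=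
  fun i j => (M (Sum.inl i) (Sum.inr j)).re

/-- The trace of the upper left block. -/
def traceInl (M : Matrix (m ⊕ n) (m ⊕ n) ℂ) : ℝ := ∑ i, (M (Sum.inl i) (Sum.inl i)).re

/-- The trace of the lower right block. -/
def traceInr (M : Matrix (m ⊕ n) (m ⊕ n) ℂ) : ℝ := ∑ j, (M (Sum.inr j) (Sum.inr j)).re

/-- The trace of `Hᵀ M₁₁ H` for the upper left block `M₁₁`. -/
def quadInl (M : Matrix (m ⊕ n) (m ⊕ n) ℂ) (H : m → n → ℝ) : ℝ :=
  ∑ j, ∑ i, ∑ i', H i j * H i' j * (M (Sum.inl i) (Sum.inl i')).re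

open scoped MatrixOrder Matrix.Norms.L2Operator in
/-- The real part of a positive semidefinite matrix is a Gram matrix. -/
lemma exists_gram_re {ι : Type*} [Fintype ι] [DecidableEq ι] {M : Matrix ι ι ℂ}
    (hM : M.PosSemidef) :
    ∃ r : ι ⊕ ι → ι → ℝ, ∀ x y, (M x y).re = ∑ k, r k x * r k y := by
  obtain ⟨B, rfl⟩ := CStarAlgebra.nonneg_iff_eq_star_mul_self.mp hM.nonneg
  refine ⟨Sum.elim (fun k x => (B k x).re) (fun k x => (B k x).im), fun x y => ?_⟩
  simp [Matrix.mul_apply, Matrix.star_apply, Fintype.sum_sum_type, Finset.sum_add_distrib]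

lemma frobInner_sq_le (K G : m → n → ℝ) :
    frobInner K G ^ 2 ≤ frobInner K K * frobInner G G := by
  have h : ∀ A B : m → n → ℝ, frobInner A B = ∑ p : m × n, A p.1 p.2 * B p.1 p.2 :=
    fun A B => by rw [Fintype.sum_prod_type]; rfl
  rw [h, h, h]
  simpa [pow_two] using Finset.sum_mul_sq_le_sq_mul_sq Finset.univ
    (fun p : m × n => K p.1 p.2) (fun p : m × n => G p.1 p.2)

lemma frobInner_comm (K G : m → n → ℝ) : frobInner K G = frobInner G K := by
  simp only [frobInner, mul_comm]

lemma frobInner_self_nonneg (K : m → n → ℝ) : 0 ≤ frobInner K K :=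
  Finset.sum_nonneg fun _ _ => Finset.sum_nonneg fun _ _ => mul_self_nonneg _

lemma frobInner_add_left (A B G : m → n → ℝ) :
    frobInner (A + B) G = frobInner A G + frobInner B G := by
  simp [frobInner, add_mul, Finset.sum_add_distrib]

lemma frobInner_add_right (G A B : m → n → ℝ) :
    frobInner G (A + B) = frobInner G A + frobInner G B := by
  simp [frobInner, mul_add, Finset.sum_add_distrib]

lemma frobInner_smul_left (c : ℝ) (A G : m → n → ℝ) :
    frobInner (c • A) G = c * frobInner A G := by
  simp [frobInner, Finset.mul_sum, mul_assoc]

lemma frobInner_smul_right (c : ℝ) (G A : m → n → ℝ) :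
    frobInner G (c • A) = c * frobInner G A := by
  rw [frobInner_comm, frobInner_smul_left, frobInner_comm]

lemma frobInner_neg_left (A G : m → n → ℝ) : frobInner (-A) G = -frobInner A G := by
  simp [frobInner]

lemma frobInner_neg_right (G A : m → n → ℝ) : frobInner G (-A) = -frobInner G A := by
  simp [frobInner]

lemma quadInl_eq {κ : Type*} [Fintype κ] {M : Matrix (m ⊕ n) (m ⊕ n) ℂ} {r : κ → m ⊕ n → ℝ}
    (hr : ∀ x y, (M x y).re = ∑ k, r k x * r k y) (H : m → n → ℝ) :
    quadInl M H = ∑ j, ∑ k, (∑ i, r k (Sum.inl i) * H i j) ^ 2 := by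
  simp only [quadInl, hr, pow_two, Finset.sum_mul_sum]
  refine Finset.sum_congr rfl fun j _ => ?_
  conv_rhs => rw [Finset.sum_comm]
  refine Finset.sum_congr rfl fun i _ => ?_
  conv_rhs => rw [Finset.sum_comm]
  refine Finset.sum_congr rfl fun i' _ => ?_
  rw [Finset.mul_sum]
  exact Finset.sum_congr rfl fun k _ => by ring

variable [DecidableEq m] [DecidableEq n] {M : Matrix (m ⊕ n) (m ⊕ n) ℂ}

lemma traceInl_nonneg (hM : M.PosSemidef) : 0 ≤ traceInl M := by
  obtain ⟨r, hr⟩ := exists_gram_re hM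
  exact Finset.sum_nonneg fun i _ => by
    rw [hr]; exact Finset.sum_nonneg fun k _ => mul_self_nonneg _

lemma traceInr_nonneg (hM : M.PosSemidef) : 0 ≤ traceInr M := by
  obtain ⟨r, hr⟩ := exists_gram_re hM
  exact Finset.sum_nonneg fun i _ => by
    rw [hr]; exact Finset.sum_nonneg fun k _ => mul_self_nonneg _

lemma frobInner_offDiagRe_self_le (hM : M.PosSemidef) :
    frobInner (offDiagRe M) (offDiagRe M) ≤ traceInl M * traceInr M := by
  obtain ⟨r, hr⟩ := exists_gram_re hM
  simp only [frobInner, offDiagRe, traceInl, traceInr, hr]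
  rw [Finset.sum_mul_sum]
  refine Finset.sum_le_sum fun i _ => Finset.sum_le_sum fun j _ => ?_
  simpa [pow_two] using Finset.sum_mul_sq_le_sq_mul_sq Finset.univ
    (fun k => r k (Sum.inl i)) (fun k => r k (Sum.inr j))

-- In a Gram representation the pairing is a sum of bilinear forms of `X` at pairs of vectors. Each
-- is bounded by the operator norm, and Cauchy-Schwarz sums the products of lengths. This is where
-- truncating the operator norm of `G` pays off.
open scoped Matrix.Norms.L2Operator in
lemma frobInner_offDiagRe_le (hM : M.PosSemidef) (X : m → n → ℝ) :
    frobInner X (offDiagRe M) ≤ ‖Matrix.of X‖ * √(traceInl M * traceInr M) := by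
  obtain ⟨r, hr⟩ := exists_gram_re hM
  have h1 : frobInner X (offDiagRe M)
      = ∑ k, ∑ i, ∑ j, r k (Sum.inl i) * X i j * r k (Sum.inr j) := by
    simp only [frobInner, offDiagRe, hr, Finset.mul_sum]
    conv_rhs => rw [Finset.sum_comm]
    refine Finset.sum_congr rfl fun i _ => ?_
    rw [Finset.sum_comm]
    exact Finset.sum_congr rfl fun k _ => Finset.sum_congr rfl fun j _ => by ring
  have hl : traceInl M = ∑ k, ∑ i, r k (Sum.inl i) ^ 2 := by
    simp only [traceInl, hr]; rw [Finset.sum_comm]; simp only [pow_two]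
  have hrr : traceInr M = ∑ k, ∑ i, r k (Sum.inr i) ^ 2 := by
    simp only [traceInr, hr]; rw [Finset.sum_comm]; simp only [pow_two]
  rw [h1, Real.sqrt_mul (traceInl_nonneg hM), hl, hrr]
  calc _ ≤ ∑ k, ‖Matrix.of X‖ *
        (√(∑ i, r k (Sum.inl i) ^ 2) * √(∑ j, r k (Sum.inr j) ^ 2)) :=
        Finset.sum_le_sum fun k _ => bilin_le_opNorm X _ _
    _ = ‖Matrix.of X‖ * ∑ k, √(∑ i, r k (Sum.inl i) ^ 2) * √(∑ j, r k (Sum.inr j) ^ 2) := by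
        rw [Finset.mul_sum]
    _ ≤ _ := by
        gcongr
        exact Real.sum_sqrt_mul_sqrt_le _ (fun k => Finset.sum_nonneg fun i _ => sq_nonneg _)
          (fun k => Finset.sum_nonneg fun i _ => sq_nonneg _)

open scoped Matrix.Norms.L2Operator in
lemma abs_frobInner_offDiagRe_le (hM : M.PosSemidef) (X : m → n → ℝ) :
    |frobInner X (offDiagRe M)| ≤ ‖Matrix.of X‖ * √(traceInl M * traceInr M) := by
  refine abs_le'.mpr ⟨frobInner_offDiagRe_le hM X, ?_⟩
  have h := frobInner_offDiagRe_le hM (-X)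
  rw [frobInner_neg_left] at h
  have : ‖Matrix.of (-X)‖ = ‖Matrix.of X‖ := norm_neg (Matrix.of X)
  rwa [this] at h

/-- Here `H` is kept with the upper left block, so that summing over the outcomes of a POVM turns
`quadInl` into `‖H‖²`. -/
lemma frobInner_offDiagRe_sq_le (hM : M.PosSemidef) (H : m → n → ℝ) :
    frobInner H (offDiagRe M) ^ 2 ≤ quadInl M H * traceInr M := by
  obtain ⟨r, hr⟩ := exists_gram_re hM
  have h1 : frobInner H (offDiagRe M)
      = ∑ p : ((m ⊕ n) ⊕ (m ⊕ n)) × n,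
        (∑ i, r p.1 (Sum.inl i) * H i p.2) * r p.1 (Sum.inr p.2) := by
    rw [Fintype.sum_prod_type]
    simp only [frobInner, offDiagRe, hr, Finset.mul_sum, Finset.sum_mul]
    rw [Finset.sum_comm]
    conv_rhs => rw [Finset.sum_comm]
    refine Finset.sum_congr rfl fun j _ => ?_
    rw [Finset.sum_comm]
    exact Finset.sum_congr rfl fun k _ => Finset.sum_congr rfl fun i _ => by ring
  have h2 : quadInl M H = ∑ p : ((m ⊕ n) ⊕ (m ⊕ n)) × n,
        (∑ i, r p.1 (Sum.inl i) * H i p.2) ^ 2 := by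
    rw [Fintype.sum_prod_type, Finset.sum_comm, quadInl_eq hr]
  have h3 : traceInr M = ∑ p : ((m ⊕ n) ⊕ (m ⊕ n)) × n, r p.1 (Sum.inr p.2) ^ 2 := by
    rw [Fintype.sum_prod_type, Finset.sum_comm]
    simp only [traceInr, hr, pow_two]
  rw [h1, h2, h3]
  exact Finset.sum_mul_sq_le_sq_mul_sq _ _ _

end PositiveBlocks

/-! ### Scores of one measurement: linearity, size and covariance. -/

section Scores

variable {d₁ d₂ : ℕ} {Z : Type*} [Fintype Z]

lemma POVM.prob_nullState (P : POVM (Fin d₁ ⊕ Fin d₂) Z) (α : Fin d₁ → ℝ) (β : Fin d₂ → ℝ)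
    (z : Z) : P.prob (nullState α β) z
      = ∑ i, α i * (P.elem z (Sum.inl i) (Sum.inl i)).re
        + ∑ j, β j * (P.elem z (Sum.inr j) (Sum.inr j)).re := by
  simp [POVM.prob, nullState, Matrix.trace, Matrix.mul_apply, Fintype.sum_sum_type,
    Matrix.diagonal_apply, ite_mul]

lemma POVM.prob_altState (P : POVM (Fin d₁ ⊕ Fin d₂) Z) (α : Fin d₁ → ℝ) (β : Fin d₂ → ℝ)
    (ε : ℝ) (G : Fin d₁ → Fin d₂ → ℝ) (z : Z) : P.prob (altState α β ε G) z
      = P.prob (nullState α β) z + 2 * (ε / d₂) * frobInner G (offDiagRe (P.elem z)) := by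
  rw [P.prob_nullState]
  have hH : ∀ i j, (P.elem z (Sum.inr j) (Sum.inl i)).re = (P.elem z (Sum.inl i) (Sum.inr j)).re :=
    fun i j => by
      have := (P.posSemidef z).isHermitian.apply (Sum.inl i) (Sum.inr j)
      rw [← this]; simp
  have h1 : P.prob (altState α β ε G) z
      = (∑ i, α i * (P.elem z (Sum.inl i) (Sum.inl i)).re
          + ∑ j, ∑ i, ε / d₂ * G i j * (P.elem z (Sum.inl i) (Sum.inr j)).re)
        + (∑ i, ∑ j, ε / d₂ * G i j * (P.elem z (Sum.inr j) (Sum.inl i)).re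
          + ∑ j, β j * (P.elem z (Sum.inr j) (Sum.inr j)).re) := by
    simp only [POVM.prob, altState, Matrix.trace, Matrix.mul_apply, Fintype.sum_sum_type,
      Matrix.diag_apply, Complex.add_re, Complex.re_sum, Matrix.fromBlocks_apply₁₁,
      Matrix.fromBlocks_apply₁₂, Matrix.fromBlocks_apply₂₁, Matrix.fromBlocks_apply₂₂,
      Matrix.diagonal_apply, ite_mul, Finset.sum_add_distrib, apply_ite Complex.re]
    congr 2
    · simp
    · refine Finset.sum_congr rfl fun j _ => Finset.sum_congr rfl fun i _ => ?_
      simp only [Matrix.conjTranspose_apply, Matrix.smul_apply, Matrix.map_apply, Matrix.of_apply,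
        smul_eq_mul, ← Complex.ofReal_mul, Complex.star_def, Complex.conj_ofReal,
        Complex.re_ofReal_mul]
    · refine Finset.sum_congr rfl fun i _ => Finset.sum_congr rfl fun j _ => ?_
      simp only [Matrix.smul_apply, Matrix.map_apply, Matrix.of_apply,
        smul_eq_mul, ← Complex.ofReal_mul, Complex.re_ofReal_mul]
    · simp
  rw [h1, Finset.sum_comm (f := fun j i => ε / d₂ * G i j * _)]
  simp only [hH, frobInner, offDiagRe, Finset.mul_sum]
  have : ∀ i j, 2 * (ε / d₂) * (G i j * (P.elem z (Sum.inl i) (Sum.inr j)).re)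
      = ε / d₂ * G i j * (P.elem z (Sum.inl i) (Sum.inr j)).re
        + ε / d₂ * G i j * (P.elem z (Sum.inl i) (Sum.inr j)).re := fun i j => by ring
  simp only [this, Finset.sum_add_distrib]
  ring

lemma POVM.sum_elem_re {ι : Type*} [Fintype ι] [DecidableEq ι] (P : POVM ι Z) (x y : ι) :
    ∑ z, (P.elem z x y).re = if x = y then 1 else 0 := by
  have := congrFun (congrFun P.sum_eq_one x) y
  rw [Matrix.sum_apply] at this
  rw [← Complex.re_sum, this, Matrix.one_apply]
  split_ifs <;> simp

/-- The relative change of the probability of the outcome `z` that is caused by a perturbation of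
the off-diagonal blocks is linear in the perturbation; this is its gradient. -/
noncomputable def POVM.score (P : POVM (Fin d₁ ⊕ Fin d₂) Z) (α : Fin d₁ → ℝ) (β : Fin d₂ → ℝ) (ε : ℝ) (z : Z) :
    Fin d₁ → Fin d₂ → ℝ :=
  (2 * (ε / d₂) / P.prob (nullState α β) z) • offDiagRe (P.elem z)

variable (P : POVM (Fin d₁ ⊕ Fin d₂) Z) {α : Fin d₁ → ℝ} {β : Fin d₂ → ℝ} {a b ε : ℝ}

lemma POVM.prob_nullState_ge (hα : ∀ i, a ≤ α i) (hβ : ∀ j, b ≤ β j) (z : Z) :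
    a * traceInl (P.elem z) + b * traceInr (P.elem z) ≤ P.prob (nullState α β) z := by
  rw [P.prob_nullState]
  obtain ⟨r, hr⟩ := exists_gram_re (P.posSemidef z)
  have hd : ∀ x, 0 ≤ (P.elem z x x).re := fun x => by
    rw [hr]; exact Finset.sum_nonneg fun k _ => mul_self_nonneg _
  unfold traceInl traceInr
  rw [Finset.mul_sum, Finset.mul_sum]
  exact add_le_add (Finset.sum_le_sum fun i _ => mul_le_mul_of_nonneg_right (hα i) (hd _))
    (Finset.sum_le_sum fun i _ => mul_le_mul_of_nonneg_right (hβ i) (hd _))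

lemma POVM.prob_nullState_nonneg (ha : 0 < a) (hb : 0 < b) (hα : ∀ i, a ≤ α i) (hβ : ∀ j, b ≤ β j)
    (z : Z) : 0 ≤ P.prob (nullState α β) z :=
  le_trans (add_nonneg (mul_nonneg ha.le (traceInl_nonneg (P.posSemidef z)))
    (mul_nonneg hb.le (traceInr_nonneg (P.posSemidef z)))) (P.prob_nullState_ge hα hβ z)

lemma POVM.sum_prob_nullState (h1 : ∑ i, α i + ∑ j, β j = 1) :
    ∑ z, P.prob (nullState α β) z = 1 := by
  simp only [P.prob_nullState, Finset.sum_add_distrib]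
  rw [Finset.sum_comm, Finset.sum_comm (f := fun z j => β j * _)]
  simp only [← Finset.mul_sum, P.sum_elem_re]
  simpa using h1

lemma POVM.sum_prob_altState (h1 : ∑ i, α i + ∑ j, β j = 1) (G : Fin d₁ → Fin d₂ → ℝ) :
    ∑ z, P.prob (altState α β ε G) z = 1 := by
  simp only [P.prob_altState, Finset.sum_add_distrib, P.sum_prob_nullState h1, frobInner,
    ← Finset.mul_sum, offDiagRe]
  rw [Finset.sum_comm]
  simp_rw [Finset.sum_comm (s := (Finset.univ : Finset Z)), ← Finset.mul_sum, P.sum_elem_re]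
  simp

/-- Two positive numbers: the bound that controls all relative changes. -/
lemma sqrt_mul_sqrt_le_half {T₁ T₂ : ℝ} (ha : 0 < a) (hb : 0 < b) (h₁ : 0 ≤ T₁) (h₂ : 0 ≤ T₂) :
    √(a * b) * √(T₁ * T₂) ≤ (a * T₁ + b * T₂) / 2 := by
  rw [← Real.sqrt_mul (by positivity)]
  refine Real.sqrt_le_iff.mpr ⟨by positivity, ?_⟩
  nlinarith [sq_nonneg (a * T₁ - b * T₂)]

/-- An outcome impossible under `H₀` has vanishing diagonal blocks, hence by positivity no
off-diagonal block. So the value `0` that division by zero gives its score is the right one. -/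
lemma POVM.offDiagRe_eq_zero (ha : 0 < a) (hb : 0 < b) (hα : ∀ i, a ≤ α i) (hβ : ∀ j, b ≤ β j)
    (z : Z) (h0 : P.prob (nullState α β) z = 0) (i : Fin d₁) (j : Fin d₂) :
    offDiagRe (P.elem z) i j = 0 := by
  have hl := traceInl_nonneg (P.posSemidef z)
  have hr := traceInr_nonneg (P.posSemidef z)
  have h := P.prob_nullState_ge hα hβ z
  rw [h0] at h
  have hl0 : traceInl (P.elem z) = 0 := by nlinarith [mul_nonneg ha.le hl, mul_nonneg hb.le hr]
  have h1 := frobInner_offDiagRe_self_le (P.posSemidef z)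
  rw [hl0, zero_mul] at h1
  have h2 := le_antisymm h1 (frobInner_self_nonneg _)
  have h3 := (Finset.sum_eq_zero_iff_of_nonneg fun i _ =>
    Finset.sum_nonneg fun j _ => mul_self_nonneg (offDiagRe (P.elem z) i j)).mp h2 i
    (Finset.mem_univ i)
  have h4 := (Finset.sum_eq_zero_iff_of_nonneg fun j _ =>
    mul_self_nonneg (offDiagRe (P.elem z) i j)).mp h3 j (Finset.mem_univ j)
  exact mul_self_eq_zero.mp h4

lemma POVM.prob_mul_frobInner_score (ha : 0 < a) (hb : 0 < b) (hα : ∀ i, a ≤ α i)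
    (hβ : ∀ j, b ≤ β j) (z : Z) (G : Fin d₁ → Fin d₂ → ℝ) :
    P.prob (nullState α β) z * frobInner G (P.score α β ε z)
      = 2 * (ε / d₂) * frobInner G (offDiagRe (P.elem z)) := by
  rw [POVM.score, frobInner_smul_right]
  by_cases h0 : P.prob (nullState α β) z = 0
  · have : frobInner G (offDiagRe (P.elem z)) = 0 := by
      simp [frobInner, P.offDiagRe_eq_zero ha hb hα hβ z h0]
    rw [this]; simp
  · field_simp

lemma POVM.prob_altState_eq_mul (ha : 0 < a) (hb : 0 < b) (hα : ∀ i, a ≤ α i)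
    (hβ : ∀ j, b ≤ β j) (z : Z) (G : Fin d₁ → Fin d₂ → ℝ) :
    P.prob (altState α β ε G) z
      = P.prob (nullState α β) z * (1 + frobInner G (P.score α β ε z)) := by
  rw [P.prob_altState, mul_add, mul_one, P.prob_mul_frobInner_score ha hb hα hβ]

-- By AM-GM the null probability is at least `2√(ab)` times the geometric mean of the block traces,
-- and the perturbation is bounded by `‖G‖` times that geometric mean. This keeps the factors `1 +
-- ⟨K, G⟩` away from `0` on the truncation event.
open scoped Matrix.Norms.L2Operator in
lemma POVM.abs_frobInner_score_le (ha : 0 < a) (hb : 0 < b) (hα : ∀ i, a ≤ α i)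
    (hβ : ∀ j, b ≤ β j) (hε : 0 ≤ ε) (hs : 6 * (ε / d₂) ≤ √(a * b)) (z : Z)
    (G : Fin d₁ → Fin d₂ → ℝ) (hG : ‖Matrix.of G‖ ≤ 3) :
    |frobInner G (P.score α β ε z)| ≤ 1 / 2 := by
  have hp := P.prob_nullState_nonneg ha hb hα hβ z
  have hl := traceInl_nonneg (P.posSemidef z)
  have hr := traceInr_nonneg (P.posSemidef z)
  have h1 := P.prob_nullState_ge hα hβ z
  have h2 := sqrt_mul_sqrt_le_half ha hb hl hr
  have h3 := abs_frobInner_offDiagRe_le (P.posSemidef z) G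
  rw [POVM.score, frobInner_smul_right, abs_mul, abs_div, abs_of_nonneg hp,
    abs_of_nonneg (by positivity), div_mul_eq_mul_div]
  refine div_le_of_le_mul₀ hp (by norm_num) ?_
  calc 2 * (ε / d₂) * |frobInner G (offDiagRe (P.elem z))|
      ≤ 2 * (ε / d₂) * (3 * √(traceInl (P.elem z) * traceInr (P.elem z))) := by
        gcongr; exact h3.trans (by gcongr)
    _ = 6 * (ε / d₂) * √(traceInl (P.elem z) * traceInr (P.elem z)) := by ring
    _ ≤ √(a * b) * √(traceInl (P.elem z) * traceInr (P.elem z)) := by gcongr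
    _ ≤ _ := by linarith

lemma POVM.frobInner_score_self_le (ha : 0 < a) (hb : 0 < b) (hα : ∀ i, a ≤ α i)
    (hβ : ∀ j, b ≤ β j) (hε : 0 ≤ ε) (hs : 6 * (ε / d₂) ≤ √(a * b)) (z : Z) :
    frobInner (P.score α β ε z) (P.score α β ε z) ≤ 1 / 36 := by
  have hp := P.prob_nullState_nonneg ha hb hα hβ z
  have hl := traceInl_nonneg (P.posSemidef z)
  have hr := traceInr_nonneg (P.posSemidef z)
  have h1 := P.prob_nullState_ge hα hβ z
  have h2 := sqrt_mul_sqrt_le_half ha hb hl hr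
  have h3 := frobInner_offDiagRe_self_le (P.posSemidef z)
  rw [POVM.score, frobInner_smul_right, frobInner_smul_left, ← mul_assoc, ← pow_two, div_pow,
    div_mul_eq_mul_div]
  refine div_le_of_le_mul₀ (by positivity) (by norm_num) ?_
  set T := √(traceInl (P.elem z) * traceInr (P.elem z))
  have hT : T ^ 2 = traceInl (P.elem z) * traceInr (P.elem z) := Real.sq_sqrt (by positivity)
  rw [← hT] at h3
  have h4 : 6 * (ε / d₂) * T ≤ P.prob (nullState α β) z / 2 := by
    calc _ ≤ √(a * b) * T := by gcongr
      _ ≤ _ := by linarith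
  calc (2 * (ε / d₂)) ^ 2 * frobInner (offDiagRe (P.elem z)) (offDiagRe (P.elem z))
      ≤ (2 * (ε / d₂)) ^ 2 * T ^ 2 := by gcongr
    _ = 1 / 9 * (6 * (ε / d₂) * T) ^ 2 := by ring
    _ ≤ 1 / 9 * (P.prob (nullState α β) z / 2) ^ 2 := by gcongr
    _ = _ := by ring

lemma POVM.sum_prob_mul_frobInner_score (ha : 0 < a) (hb : 0 < b) (hα : ∀ i, a ≤ α i)
    (hβ : ∀ j, b ≤ β j) (H : Fin d₁ → Fin d₂ → ℝ) :
    ∑ z, P.prob (nullState α β) z * frobInner H (P.score α β ε z) = 0 := by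
  simp_rw [P.prob_mul_frobInner_score ha hb hα hβ]
  simp only [frobInner, ← Finset.mul_sum, offDiagRe]
  rw [Finset.sum_comm]
  simp_rw [Finset.sum_comm (s := (Finset.univ : Finset Z)), ← Finset.mul_sum, P.sum_elem_re]
  simp

/-- One factor of the null probability, at least `b` times the lower trace, absorbs that trace. The
upper traces add up to `d₁`, which is why the dimension factor is `d₁` and not `d₁d₂`. -/
lemma POVM.sum_prob_mul_frobInner_score_self_le (ha : 0 < a) (hb : 0 < b) (hα : ∀ i, a ≤ α i)
    (hβ : ∀ j, b ≤ β j) :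
    ∑ z, P.prob (nullState α β) z * frobInner (P.score α β ε z) (P.score α β ε z)
      ≤ 4 * (ε / d₂) ^ 2 / b * d₁ := by
  have hsum : ∑ z, traceInl (P.elem z) = d₁ := by
    simp only [traceInl]; rw [Finset.sum_comm]; simp [P.sum_elem_re]
  rw [← hsum, Finset.mul_sum]
  refine Finset.sum_le_sum fun z _ => ?_
  have hp := P.prob_nullState_nonneg ha hb hα hβ z
  have hl := traceInl_nonneg (P.posSemidef z)
  have hr := traceInr_nonneg (P.posSemidef z)
  have h1 := P.prob_nullState_ge hα hβ z
  have h3 := frobInner_offDiagRe_self_le (P.posSemidef z)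
  rw [P.prob_mul_frobInner_score ha hb hα hβ, POVM.score, frobInner_smul_left, ← mul_assoc,
    mul_div_assoc', div_mul_eq_mul_div]
  refine div_le_of_le_mul₀ hp (by positivity) ?_
  calc 2 * (ε / d₂) * (2 * (ε / d₂)) * frobInner (offDiagRe (P.elem z)) (offDiagRe (P.elem z))
      ≤ 2 * (ε / d₂) * (2 * (ε / d₂)) * (traceInl (P.elem z) * traceInr (P.elem z)) :=
        mul_le_mul_of_nonneg_left h3 (mul_self_nonneg _)
    _ = 4 * (ε / d₂) ^ 2 / b * traceInl (P.elem z) * (b * traceInr (P.elem z)) := by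
        field_simp; ring
    _ ≤ _ := by
        gcongr
        nlinarith [mul_nonneg ha.le hl]

lemma POVM.sum_prob_mul_frobInner_score_sq_le (ha : 0 < a) (hb : 0 < b) (hα : ∀ i, a ≤ α i)
    (hβ : ∀ j, b ≤ β j) (H : Fin d₁ → Fin d₂ → ℝ) :
    ∑ z, P.prob (nullState α β) z * frobInner H (P.score α β ε z) ^ 2
      ≤ 4 * (ε / d₂) ^ 2 / b * frobInner H H := by
  have hsum : ∑ z, quadInl (P.elem z) H = frobInner H H := by
    simp only [quadInl]
    rw [Finset.sum_comm]
    simp_rw [Finset.sum_comm (s := (Finset.univ : Finset Z)), ← Finset.mul_sum, P.sum_elem_re]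
    rw [frobInner, Finset.sum_comm]
    simp
  rw [← hsum, Finset.mul_sum]
  refine Finset.sum_le_sum fun z _ => ?_
  have hp := P.prob_nullState_nonneg ha hb hα hβ z
  have hl := traceInl_nonneg (P.posSemidef z)
  have hr := traceInr_nonneg (P.posSemidef z)
  have h1 := P.prob_nullState_ge hα hβ z
  have h3 := frobInner_offDiagRe_sq_le (P.posSemidef z) H
  have hq : 0 ≤ quadInl (P.elem z) H := by
    obtain ⟨r, hr⟩ := exists_gram_re (P.posSemidef z)
    rw [quadInl_eq hr]
    exact Finset.sum_nonneg fun j _ => Finset.sum_nonneg fun k _ => sq_nonneg _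
  rw [pow_two, ← mul_assoc, P.prob_mul_frobInner_score ha hb hα hβ, POVM.score,
    frobInner_smul_right, mul_comm, mul_assoc, mul_comm (frobInner H _), div_mul_eq_mul_div,
    mul_comm (2 * (ε / d₂)) (frobInner H _)]
  refine div_le_of_le_mul₀ hp (by positivity) ?_
  calc _ = 4 * (ε / d₂) ^ 2 * frobInner H (offDiagRe (P.elem z)) ^ 2 := by ring
    _ ≤ 4 * (ε / d₂) ^ 2 * (quadInl (P.elem z) H * traceInr (P.elem z)) := by gcongr
    _ = 4 * (ε / d₂) ^ 2 / b * quadInl (P.elem z) H * (b * traceInr (P.elem z)) := by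
        field_simp
    _ ≤ _ := by
        gcongr
        nlinarith [mul_nonneg ha.le hl]

end Scores

/-! ### The martingale of scores under the null hypothesis. -/

section AdaptiveWalk

variable {Z m n : Type*} [Fintype Z] [Fintype m] [Fintype n]

/-- The mean of a function of the first `t` outcomes (the latest one first) of a process whose next
outcome, given the history `h`, is `z` with probability `κ h z`. -/
def treeMean (κ : List Z → Z → ℝ) : ℕ → (List Z → ℝ) → ℝ
  | 0, f => f []
  | t + 1, f => treeMean κ t fun h => ∑ z, κ h z * f (z :: h)

section Mean

variable {κ : List Z → Z → ℝ}

lemma treeMean_mono (hκ : ∀ h z, 0 ≤ κ h z) (t : ℕ) {f g : List Z → ℝ}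
    (hfg : ∀ h, h.length = t → f h ≤ g h) : treeMean κ t f ≤ treeMean κ t g := by
  induction t generalizing f g with
  | zero => exact hfg [] rfl
  | succ t ih =>
    exact ih fun h hh => Finset.sum_le_sum fun z _ =>
      mul_le_mul_of_nonneg_left (hfg _ (by simp [hh])) (hκ h z)

lemma treeMean_add (t : ℕ) (f g : List Z → ℝ) :
    treeMean κ t (fun h => f h + g h) = treeMean κ t f + treeMean κ t g := by
  induction t generalizing f g with
  | zero => rfl
  | succ t ih => simp only [treeMean, mul_add, Finset.sum_add_distrib, ih]

lemma treeMean_const_mul (t : ℕ) (c : ℝ) (f : List Z → ℝ) :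
    treeMean κ t (fun h => c * f h) = c * treeMean κ t f := by
  induction t generalizing f with
  | zero => rfl
  | succ t ih => simp only [treeMean, mul_left_comm _ c, ← Finset.mul_sum, ih]

lemma treeMean_const (t : ℕ) (hκ : ∀ h, h.length < t → ∑ z, κ h z = 1) (c : ℝ)
    (hκ0 : ∀ h z, 0 ≤ κ h z) : treeMean κ t (fun _ => c) = c := by
  induction t with
  | zero => rfl
  | succ t ih =>
    have h1 : ∀ h : List Z, h.length = t → ∑ z, κ h z * c = c := fun h hh => by
      rw [← Finset.sum_mul, hκ h (by omega), one_mul]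
    refine Eq.trans (le_antisymm (treeMean_mono hκ0 t fun h hh => (h1 h hh).le)
      (treeMean_mono hκ0 t fun h hh => (h1 h hh).ge)) (ih fun h hh => hκ h (by omega))

end Mean

/-- The matrices attached to the steps of a history. -/
def scoreList (K : List Z → Z → m → n → ℝ) : List Z → List (m → n → ℝ)
  | [] => []
  | z :: h => K h z :: scoreList K h

open scoped Classical in
/-- The sum of the matrices attached to the steps, stopped when its Frobenius norm exceeds `R`. -/
noncomputable def stoppedSum (K : List Z → Z → m → n → ℝ) (R : ℝ) : List Z → m → n → ℝ
  | [] => 0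
  | z :: h => stoppedSum K R h +
      (if frobInner (stoppedSum K R h) (stoppedSum K R h) ≤ R ^ 2 then (1 : ℝ) else 0) • K h z

/-- The sum of the squared Frobenius norms of the members of a list. -/
def listSq (l : List (m → n → ℝ)) : ℝ := (l.map fun A => frobInner A A).sum

/-- The value at `H` of the sum of the members of a list. -/
def listLin (l : List (m → n → ℝ)) (H : m → n → ℝ) : ℝ := (l.map fun A => frobInner A H).sum

/-- The value at `H` of the sum of the squares of the members of a list. -/
def listQuad (l : List (m → n → ℝ)) (H : m → n → ℝ) : ℝ := (l.map fun A => frobInner A H ^ 2).sum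

lemma listLin_smul (l : List (m → n → ℝ)) (c : ℝ) (H : m → n → ℝ) :
    listLin l (c • H) = c * listLin l H := by
  induction l with
  | nil => simp [listLin]
  | cons A l ih =>
    simp only [listLin, List.map_cons, List.sum_cons] at *
    rw [ih, frobInner_smul_right]; ring

lemma listQuad_smul (l : List (m → n → ℝ)) (c : ℝ) (H : m → n → ℝ) :
    listQuad l (c • H) = c ^ 2 * listQuad l H := by
  induction l with
  | nil => simp [listQuad]
  | cons A l ih =>
    simp only [listQuad, List.map_cons, List.sum_cons] at *
    rw [ih, frobInner_smul_right]; ring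

/-- A process with centred matrix valued steps whose covariance is at most `q`, in a space where
their squared norms have mean at most `q * D`. -/
structure IsCentredWalk (κ : List Z → Z → ℝ) (K : List Z → Z → m → n → ℝ) (N : ℕ) (q D : ℝ) :
    Prop where
  nonneg : ∀ h z, 0 ≤ κ h z
  q_nonneg : 0 ≤ q
  D_nonneg : 0 ≤ D
  sum_one : ∀ h, h.length < N → ∑ z, κ h z = 1
  mean_zero : ∀ h, h.length < N → ∀ H, ∑ z, κ h z * frobInner H (K h z) = 0
  mean_sq : ∀ h, h.length < N → ∑ z, κ h z * frobInner (K h z) (K h z) ≤ q * D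
  cov : ∀ h, h.length < N → ∀ H, ∑ z, κ h z * frobInner H (K h z) ^ 2 ≤ q * frobInner H H
  bdd : ∀ h z, h.length < N → frobInner (K h z) (K h z) ≤ 1 / 36

namespace IsCentredWalk

variable {κ : List Z → Z → ℝ} {K : List Z → Z → m → n → ℝ} {N : ℕ} {q D : ℝ}

lemma sum_listLin (P : IsCentredWalk κ K N q D) {h : List Z} (hh : h.length < N)
    (l : List (m → n → ℝ)) : ∑ z, κ h z * listLin l (K h z) = 0 := by
  induction l with
  | nil => simp [listLin]
  | cons A l ih =>
    simp only [listLin, List.map_cons, List.sum_cons, mul_add, Finset.sum_add_distrib] at *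
    rw [ih, P.mean_zero h hh, add_zero]

/-- The cross terms have mean zero, and the covariance bound applied in the direction of each past
step controls the squares. -/
lemma sum_listQuad_add_le (P : IsCentredWalk κ K N q D) {h : List Z} (hh : h.length < N)
    (l : List (m → n → ℝ)) (S : m → n → ℝ) {c : ℝ} (hc : c ^ 2 ≤ 1) :
    ∑ z, κ h z * listQuad l (S + c • K h z) ≤ listQuad l S + q * listSq l := by
  induction l with
  | nil => simp [listQuad, listSq]
  | cons A l ih =>
    simp only [listQuad, listSq, List.map_cons, List.sum_cons, mul_add, Finset.sum_add_distrib]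
      at *
    have h1 : ∑ z, κ h z * frobInner A (S + c • K h z) ^ 2
        ≤ frobInner A S ^ 2 + q * frobInner A A := by
      have : ∀ z, κ h z * frobInner A (S + c • K h z) ^ 2
          = frobInner A S ^ 2 * κ h z + 2 * c * frobInner A S * (κ h z * frobInner A (K h z))
            + c ^ 2 * (κ h z * frobInner A (K h z) ^ 2) := fun z => by
        rw [frobInner_add_right, frobInner_smul_right]; ring
      simp only [this, Finset.sum_add_distrib, ← Finset.mul_sum]
      rw [P.sum_one h hh, P.mean_zero h hh]
      have h2 := P.cov h hh A
      have h3 : 0 ≤ ∑ z, κ h z * frobInner A (K h z) ^ 2 :=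
        Finset.sum_nonneg fun z _ => mul_nonneg (P.nonneg h z) (sq_nonneg _)
      nlinarith
    linarith

-- Orthogonality of martingale increments; the stopping indicator is idempotent, so it appears only
-- once.
open scoped Classical in
lemma sum_stoppedSum_sq (P : IsCentredWalk κ K N q D) (R : ℝ) {h : List Z} (hh : h.length < N) :
    ∑ z, κ h z * frobInner (stoppedSum K R (z :: h)) (stoppedSum K R (z :: h))
      = frobInner (stoppedSum K R h) (stoppedSum K R h)
        + (if frobInner (stoppedSum K R h) (stoppedSum K R h) ≤ R ^ 2 then (1 : ℝ) else 0)
          * ∑ z, κ h z * frobInner (K h z) (K h z) := by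
  simp only [stoppedSum]
  set S := stoppedSum K R h
  generalize hc : (if frobInner S S ≤ R ^ 2 then (1 : ℝ) else 0) = c
  have hc2 : c * c = c := by rw [← hc]; split_ifs <;> norm_num
  have : ∀ z, κ h z * frobInner (S + c • K h z) (S + c • K h z)
      = frobInner S S * κ h z + 2 * c * (κ h z * frobInner S (K h z))
        + c * (κ h z * frobInner (K h z) (K h z)) := fun z => by
    simp only [frobInner_add_left, frobInner_add_right, frobInner_smul_left, frobInner_smul_right]
    rw [frobInner_comm (K h z) S]
    linear_combination (κ h z * frobInner (K h z) (K h z)) * hc2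
  simp only [this, Finset.sum_add_distrib, ← Finset.mul_sum]
  rw [P.sum_one h hh, P.mean_zero h hh]
  ring

lemma treeMean_stoppedSum_sq_le (P : IsCentredWalk κ K N q D) (R : ℝ) (t : ℕ) (ht : t ≤ N) :
    treeMean κ t (fun h => frobInner (stoppedSum K R h) (stoppedSum K R h)) ≤ t * (q * D) := by
  classical
  induction t with
  | zero => simp [treeMean, stoppedSum, frobInner]
  | succ t ih =>
    refine (treeMean_mono P.nonneg t (g := fun h =>
      frobInner (stoppedSum K R h) (stoppedSum K R h) + q * D) fun h hh => ?_).trans ?_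
    · rw [P.sum_stoppedSum_sq R (by omega)]
      have h1 := P.mean_sq h (by omega)
      have h2 : 0 ≤ q * D := mul_nonneg P.q_nonneg P.D_nonneg
      split_ifs <;> linarith
    · rw [treeMean_add, treeMean_const t (fun h hh => P.sum_one h (by omega)) _ P.nonneg]
      push_cast
      linarith [ih (by omega)]

lemma treeMean_listSq_le (P : IsCentredWalk κ K N q D) (t : ℕ) (ht : t ≤ N) :
    treeMean κ t (fun h => listSq (scoreList K h)) ≤ t * (q * D) := by
  induction t with
  | zero => simp [treeMean, scoreList, listSq]
  | succ t ih =>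
    refine (treeMean_mono P.nonneg t (g := fun h => listSq (scoreList K h) + q * D)
      fun h hh => ?_).trans ?_
    · simp only [scoreList, listSq, List.map_cons, List.sum_cons, mul_add, Finset.sum_add_distrib,
        ← Finset.sum_mul]
      rw [P.sum_one h (by omega)]
      linarith [P.mean_sq h (by omega)]
    · rw [treeMean_add, treeMean_const t (fun h hh => P.sum_one h (by omega)) _ P.nonneg]
      push_cast
      linarith [ih (by omega)]

/-- A new step has two effects. It perturbs the pairings of `S` with old steps, at mean cost `q ∑
‖K_s‖²`. It also adds its own pairing, at mean cost `2q‖S‖² + qD`. Inserting the mean bounds `tqD`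
and summing over `t` gives the claim. -/
lemma treeMean_listQuad_le (P : IsCentredWalk κ K N q D) (R : ℝ) (t : ℕ) (ht : t ≤ N) :
    treeMean κ t (fun h => listQuad (scoreList K h) (stoppedSum K R h))
      ≤ 3 * t ^ 2 * q ^ 2 * D + t * (q * D) := by
  classical
  induction t with
  | zero => simp [treeMean, scoreList, listQuad]
  | succ t ih =>
    have hq := P.q_nonneg
    have hD := P.D_nonneg
    refine (treeMean_mono P.nonneg t (g := fun h => listQuad (scoreList K h) (stoppedSum K R h)
      + (q * listSq (scoreList K h)
      + (2 * q * frobInner (stoppedSum K R h) (stoppedSum K R h) + q * D)))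
      fun h hh => ?_).trans ?_
    · have hh' : h.length < N := by omega
      simp only [scoreList, stoppedSum]
      set S := stoppedSum K R h
      generalize hc : (if frobInner S S ≤ R ^ 2 then (1 : ℝ) else 0) = c
      have hc2 : c ^ 2 ≤ 1 := by rw [← hc]; split_ifs <;> norm_num
      have h1 := P.sum_listQuad_add_le hh' (scoreList K h) S hc2
      have h2 : ∑ z, κ h z * frobInner (K h z) (S + c • K h z) ^ 2
          ≤ 2 * q * frobInner S S + q * D := by
        have h3 : ∀ z, κ h z * frobInner (K h z) (S + c • K h z) ^ 2
            ≤ 2 * (κ h z * frobInner S (K h z) ^ 2)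
              + 1 / 18 * (κ h z * frobInner (K h z) (K h z)) := fun z => by
          have h4 := P.bdd h z hh'
          have h5 := frobInner_self_nonneg (K h z)
          have h6 : frobInner (K h z) (S + c • K h z) ^ 2
              ≤ 2 * frobInner S (K h z) ^ 2 + 1 / 18 * frobInner (K h z) (K h z) := by
            rw [frobInner_add_right, frobInner_smul_right, frobInner_comm (K h z) S]
            set x := frobInner S (K h z)
            set y := frobInner (K h z) (K h z)
            have h7 : (c * y) ^ 2 ≤ 1 / 36 * y := by
              rw [mul_pow]
              nlinarith [mul_nonneg (sub_nonneg.mpr hc2) (sq_nonneg y),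
                mul_nonneg h5 (sub_nonneg.mpr h4)]
            nlinarith [sq_nonneg (x - c * y)]
          nlinarith [mul_le_mul_of_nonneg_left h6 (P.nonneg h z)]
        refine (Finset.sum_le_sum fun z _ => h3 z).trans ?_
        rw [Finset.sum_add_distrib, ← Finset.mul_sum, ← Finset.mul_sum]
        have h4 := P.cov h hh' S
        have h5 := P.mean_sq h hh'
        nlinarith [mul_nonneg hq hD]
      simp only [listQuad, List.map_cons, List.sum_cons, mul_add, Finset.sum_add_distrib] at h1 ⊢
      linarith
    · rw [treeMean_add, treeMean_add, treeMean_add, treeMean_const_mul, treeMean_const_mul,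
        treeMean_const t (fun h hh => P.sum_one h (by omega)) _ P.nonneg]
      have h1 := ih (by omega)
      have h2 := mul_le_mul_of_nonneg_left (P.treeMean_listSq_le t (by omega)) hq
      have h3 := mul_le_mul_of_nonneg_left (P.treeMean_stoppedSum_sq_le R t (by omega)) hq
      push_cast
      have h4 : 0 ≤ q ^ 2 * D := by positivity
      have h5 : 0 ≤ (t : ℝ) * (q ^ 2 * D) := by positivity
      nlinarith

/-- `listLin` pairs the unstopped sum with the stopped one. Its conditional increment is that of
`‖S‖²`, because both change only while the walk has not been stopped. -/
lemma treeMean_listLin (P : IsCentredWalk κ K N q D) (R : ℝ) (t : ℕ) (ht : t ≤ N) :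
    0 ≤ treeMean κ t (fun h => listLin (scoreList K h) (stoppedSum K R h)
      + (-1) * frobInner (stoppedSum K R h) (stoppedSum K R h)) := by
  classical
  induction t with
  | zero => simp [treeMean, scoreList, stoppedSum, listLin, frobInner]
  | succ t ih =>
    refine (ih (by omega)).trans (treeMean_mono P.nonneg t fun h hh => ?_)
    have hh' : h.length < N := by omega
    have h1 := P.sum_stoppedSum_sq R hh'
    have h2 : ∑ z, κ h z * listLin (scoreList K (z :: h)) (stoppedSum K R (z :: h))
        = listLin (scoreList K h) (stoppedSum K R h)
          + (if frobInner (stoppedSum K R h) (stoppedSum K R h) ≤ R ^ 2 then (1 : ℝ) else 0)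
          * ∑ z, κ h z * frobInner (K h z) (K h z) := by
      simp only [stoppedSum, scoreList]
      set S := stoppedSum K R h
      generalize (if frobInner S S ≤ R ^ 2 then (1 : ℝ) else 0) = c
      have h3 : ∀ l : List (m → n → ℝ), ∀ A B, listLin l (A + B) = listLin l A + listLin l B := by
        intro l A B
        induction l with
        | nil => simp [listLin]
        | cons C l ih =>
          simp only [listLin, List.map_cons, List.sum_cons, frobInner_add_right] at *
          rw [ih]; ring
      have h4 : ∀ z, κ h z * listLin (K h z :: scoreList K h) (S + c • K h z)
          = listLin (scoreList K h) S * κ h z + κ h z * frobInner S (K h z)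
            + c * (κ h z * frobInner (K h z) (K h z))
            + c * (κ h z * listLin (scoreList K h) (K h z)) := fun z => by
        have : listLin (K h z :: scoreList K h) (S + c • K h z)
            = frobInner (K h z) (S + c • K h z)
              + listLin (scoreList K h) (S + c • K h z) := by
          simp [listLin]
        rw [this, h3, listLin_smul, frobInner_add_right, frobInner_smul_right,
          frobInner_comm (K h z) S]
        ring
      simp only [h4, Finset.sum_add_distrib, ← Finset.mul_sum]
      rw [P.sum_one h hh', P.mean_zero h hh', P.sum_listLin hh']
      ring
    simp only [mul_add, Finset.sum_add_distrib, mul_left_comm _ (-1 : ℝ), ← Finset.mul_sum]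
    linarith

/-- The two quantities have equal conditional increments until stopping. Afterwards each step costs
at most `qD`, and Markov's inequality for `‖S‖²` bounds the probability of having stopped. -/
lemma treeMean_unstopped_le (P : IsCentredWalk κ K N q D) {R : ℝ} (hR : 0 < R) (t : ℕ)
    (ht : t ≤ N) :
    treeMean κ t (fun h => listSq (scoreList K h)
      + (-1) * frobInner (stoppedSum K R h) (stoppedSum K R h))
      ≤ t ^ 2 * (q * D) ^ 2 / R ^ 2 := by
  classical
  induction t with
  | zero => simp [treeMean, scoreList, stoppedSum, listSq, frobInner]
  | succ t ih =>
    have hqD : 0 ≤ q * D := mul_nonneg P.q_nonneg P.D_nonneg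
    refine (treeMean_mono P.nonneg t (g := fun h => (listSq (scoreList K h)
      + (-1) * frobInner (stoppedSum K R h) (stoppedSum K R h))
      + (q * D / R ^ 2) * frobInner (stoppedSum K R h) (stoppedSum K R h)) fun h hh => ?_).trans ?_
    · have hh' : h.length < N := by omega
      have h1 := P.sum_stoppedSum_sq R hh'
      have h2 : ∑ z, κ h z * listSq (scoreList K (z :: h))
          = listSq (scoreList K h) + ∑ z, κ h z * frobInner (K h z) (K h z) := by
        simp only [scoreList, listSq, List.map_cons, List.sum_cons, mul_add,
          Finset.sum_add_distrib, ← Finset.sum_mul]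
        rw [P.sum_one h hh']; ring
      simp only [mul_add, Finset.sum_add_distrib, mul_left_comm _ (-1 : ℝ), ← Finset.mul_sum]
      rw [h1, h2]
      have h3 := P.mean_sq h hh'
      have h4 := frobInner_self_nonneg (stoppedSum K R h)
      have h5 : 0 ≤ q * D / R ^ 2 * frobInner (stoppedSum K R h) (stoppedSum K R h) := by
        positivity
      split_ifs with hc
      · linarith
      · have h6 : q * D ≤ q * D / R ^ 2 * frobInner (stoppedSum K R h) (stoppedSum K R h) := by
          rw [div_mul_eq_mul_div, le_div_iff₀ (by positivity)]
          exact mul_le_mul_of_nonneg_left (not_le.mp hc).le hqD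
        linarith
    · rw [treeMean_add, treeMean_const_mul]
      have h1 := ih (by omega)
      have h2 := mul_le_mul_of_nonneg_left (P.treeMean_stoppedSum_sq_le R t (by omega))
        (show 0 ≤ q * D / R ^ 2 by positivity)
      have h3 : q * D / R ^ 2 * (t * (q * D)) = t * ((q * D) ^ 2 / R ^ 2) := by ring
      have h4 : 0 ≤ (q * D) ^ 2 / R ^ 2 := by positivity
      rw [h3] at h2
      push_cast
      rw [mul_div_assoc] at h1
      have h6 : ((t : ℝ) + 1) ^ 2 * (q * D) ^ 2 / R ^ 2
          = ((t : ℝ) + 1) ^ 2 * ((q * D) ^ 2 / R ^ 2) := by ring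
      rw [h6]
      have h5 : 0 ≤ (t : ℝ) * ((q * D) ^ 2 / R ^ 2) := by positivity
      nlinarith

/-- The last step before stopping may overshoot `R`, but by at most `1/6 ≤ R`. -/
lemma frobInner_stoppedSum_le (P : IsCentredWalk κ K N q D) {R : ℝ} (hR : 1 / 6 ≤ R)
    (h : List Z) (hh : h.length ≤ N) :
    frobInner (stoppedSum K R h) (stoppedSum K R h) ≤ (2 * R) ^ 2 := by
  classical
  induction h with
  | nil => simp [stoppedSum, frobInner]; positivity
  | cons z h ih =>
    simp only [List.length_cons] at hh
    simp only [stoppedSum]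
    split_ifs with hc
    · have h1 := P.bdd h z (by omega)
      have h2 := frobInner_sq_le (stoppedSum K R h) (K h z)
      have h3 := frobInner_self_nonneg (K h z)
      have h4 : frobInner (K h z) (K h z) ≤ R ^ 2 := h1.trans (by nlinarith)
      have h5 : frobInner (stoppedSum K R h) (K h z) ≤ R ^ 2 := by
        refine abs_le_of_sq_le_sq' (h2.trans ?_) (by positivity) |>.2
        rw [pow_two (R ^ 2)]
        exact mul_le_mul hc h4 h3 (by positivity)
      rw [one_smul]
      simp only [frobInner_add_left, frobInner_add_right]
      rw [frobInner_comm (K h z) (stoppedSum K R h)]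
      nlinarith
    · rw [zero_smul, add_zero]
      exact ih (by omega)

/-- The mean of the lower bound on the log-likelihood ratio. -/
lemma treeMean_logLikelihood_ge (P : IsCentredWalk κ K N q D) (hD : 0 < D) (c : ℝ)
    {e : ℝ} (he : 0 ≤ e) :
    c - (200 * (N * q) ^ 2 / D + e * (N * (q * D)) + (3 * (N * q) ^ 2 + N * q) / D)
      ≤ treeMean κ N (fun h => c
        + (listLin (scoreList K h) (D⁻¹ • stoppedSum K (D / 20) h)
        - D * frobInner (D⁻¹ • stoppedSum K (D / 20) h) (D⁻¹ • stoppedSum K (D / 20) h) / 2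
        - (1 / (2 * D) + e) * listSq (scoreList K h)
        - listQuad (scoreList K h) (D⁻¹ • stoppedSum K (D / 20) h))) := by
  set R := D / 20 with hR
  have hRpos : 0 < R := by positivity
  have h1 := P.treeMean_listLin R N le_rfl
  have h2 := P.treeMean_unstopped_le hRpos N le_rfl
  have h3 := P.treeMean_listSq_le N le_rfl
  have h4 := P.treeMean_listQuad_le R N le_rfl
  have hfun : (fun h => c
        + (listLin (scoreList K h) (D⁻¹ • stoppedSum K R h)
        - D * frobInner (D⁻¹ • stoppedSum K R h) (D⁻¹ • stoppedSum K R h) / 2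
        - (1 / (2 * D) + e) * listSq (scoreList K h)
        - listQuad (scoreList K h) (D⁻¹ • stoppedSum K R h)))
      -- Regrouping exhibits the cancellation: `‖S‖²/(2D)` is what remains of the linear and
      -- Cameron-Martin terms, and it is paired with `∑ ‖K_t‖²/(2D)`.
      = fun h => c + (D⁻¹ * (listLin (scoreList K h) (stoppedSum K R h)
          + (-1) * frobInner (stoppedSum K R h) (stoppedSum K R h))
        + ((-(1 / (2 * D))) * (listSq (scoreList K h)
          + (-1) * frobInner (stoppedSum K R h) (stoppedSum K R h))
        + ((-e) * listSq (scoreList K h)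
        + (-(D⁻¹ ^ 2)) * listQuad (scoreList K h) (stoppedSum K R h)))) := by
    funext h
    rw [listLin_smul, listQuad_smul, frobInner_smul_left, frobInner_smul_right]
    field_simp
    ring
  rw [hfun]
  simp only [treeMean_add, treeMean_const N P.sum_one _ P.nonneg, treeMean_const_mul] at h1 h2 ⊢
  have g1 := mul_nonneg (inv_nonneg.mpr hD.le) h1
  have g2 := mul_le_mul_of_nonneg_left h2 (show 0 ≤ 1 / (2 * D) by positivity)
  have g3 := mul_le_mul_of_nonneg_left h3 he
  have g4 := mul_le_mul_of_nonneg_left h4 (show 0 ≤ D⁻¹ ^ 2 by positivity)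
  have e2 : 1 / (2 * D) * (N ^ 2 * (q * D) ^ 2 / R ^ 2) = 200 * (N * q) ^ 2 / D := by
    rw [hR]; field_simp; ring
  have e4 : D⁻¹ ^ 2 * (3 * N ^ 2 * q ^ 2 * D + N * (q * D)) = (3 * (N * q) ^ 2 + N * q) / D := by
    field_simp
  rw [e2] at g2
  rw [e4] at g4
  linarith

end IsCentredWalk

end AdaptiveWalk

/-! ### Lower bound for the likelihood ratio of a leaf. -/

section Likelihood

open scoped NNReal ENNReal Nat

lemma continuous_frobInner_right {m n : Type*} [Fintype m] [Fintype n] (A : m → n → ℝ) :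
    Continuous (frobInner A) := by
  unfold frobInner; fun_prop

lemma integrable_pow_gaussianReal (v : ℝ≥0) (k : ℕ) :
    Integrable (fun x : ℝ => x ^ (2 * k)) (gaussianReal 0 v) := by
  rcases eq_or_ne v 0 with rfl | hv
  · rw [gaussianReal_zero_var]; exact integrable_dirac (by simp)
  · by_contra hni
    have h := integral_pow_gaussianReal v hv k
    rw [integral_undef hni] at h
    have : 0 < (v : ℝ) ^ k * ((2 * k - 1 : ℕ)‼ : ℝ) :=
      mul_pos (by positivity) (Nat.cast_pos.mpr (Nat.doubleFactorial_pos _))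
    linarith

variable {d₁ d₂ : ℕ}

lemma integrable_frobInner_pow_ginibre (A : Fin d₁ → Fin d₂ → ℝ) (k : ℕ) :
    Integrable (fun G => frobInner A G ^ (2 * k)) (ginibre d₁ d₂) := by
  have h := integrable_pow_gaussianReal (Real.toNNReal (frobInner A A / d₁)) k
  rw [← map_frobInner_ginibre] at h
  exact h.comp_measurable (continuous_frobInner_right A).measurable

lemma integral_frobInner_pow_ginibre (A : Fin d₁ → Fin d₂ → ℝ) (k : ℕ) (hk : k ≠ 0) :
    ∫ G, frobInner A G ^ (2 * k) ∂(ginibre d₁ d₂)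
      = (frobInner A A / d₁) ^ k * ((2 * k - 1 : ℕ)‼ : ℝ) := by
  have h0 : 0 ≤ frobInner A A / d₁ := div_nonneg (frobInner_self_nonneg A) (Nat.cast_nonneg _)
  have hm := integral_map (μ := ginibre d₁ d₂) (continuous_frobInner_right A).measurable.aemeasurable
    (f := fun x : ℝ => x ^ (2 * k)) (by fun_prop)
  rw [← hm, map_frobInner_ginibre]
  rcases eq_or_ne (Real.toNNReal (frobInner A A / d₁)) 0 with hv | hv
  · have : frobInner A A / d₁ = 0 := le_antisymm (Real.toNNReal_eq_zero.mp hv) h0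
    rw [hv, gaussianReal_zero_var, this]
    simp [hk]
  · rw [integral_pow_gaussianReal _ hv, Real.coe_toNNReal _ h0]

lemma map_neg_ginibre : (ginibre d₁ d₂).map (fun G => -G) = ginibre d₁ d₂ := by
  unfold ginibre
  have hm : Measurable fun (x : Fin d₂ → ℝ) j => -x j := by fun_prop
  have h : ∀ v : ℝ≥0, ((Measure.pi fun _ : Fin d₂ => gaussianReal 0 v).map fun x j => -x j)
      = Measure.pi fun _ => gaussianReal 0 v := fun v => by
    rw [Measure.pi_map_pi (f := fun _ x => -x) fun i => by fun_prop]
    simp [gaussianReal_map_neg]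
  change Measure.map (fun (G : Fin d₁ → Fin d₂ → ℝ) i => (fun x j => -x j) (G i)) _ = _
  have := fun i : Fin d₁ => (Measure.isProbabilityMeasure_map
    (μ := Measure.pi fun _ : Fin d₂ => gaussianReal 0 (1 / (d₁ : ℝ≥0)))
    hm.aemeasurable)
  rw [Measure.pi_map_pi (f := fun (_ : Fin d₁) (x : Fin d₂ → ℝ) j => -x j) fun i => hm.aemeasurable]
  simp_rw [h]

open scoped Matrix.Norms.L2Operator in
lemma isCompact_opNorm_le (s : ℝ) :
    IsCompact {G : Fin d₁ → Fin d₂ → ℝ | ‖Matrix.of G‖ ≤ s} := by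
  have : ProperSpace (Matrix (Fin d₁) (Fin d₂) ℝ) := FiniteDimensional.proper ℝ _
  have h : IsCompact (Metric.closedBall (0 : Matrix (Fin d₁) (Fin d₂) ℝ) s) :=
    isCompact_closedBall _ _
  have h2 : Metric.closedBall (0 : Matrix (Fin d₁) (Fin d₂) ℝ) s
      = {G : Matrix (Fin d₁) (Fin d₂) ℝ | ‖G‖ ≤ s} := by ext; simp
  rw [h2] at h
  exact h

lemma isCompact_coreEvent : IsCompact (coreEvent d₁ d₂) := by
  have h : Continuous fun G : Fin d₁ → Fin d₂ → ℝ => frobInner G G := by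
    unfold frobInner; fun_prop
  exact (isCompact_opNorm_le (29 / 10)).inter_right
    (isClosed_le (continuous_const (y := 81 / 100 * (d₂ : ℝ))) h)

lemma isCompact_ginibreEvent : IsCompact (ginibreEvent d₁ d₂) := by
  have h : Continuous fun G : Fin d₁ → Fin d₂ → ℝ => ∑ i, ∑ j, G i j ^ 2 := by fun_prop
  exact (isCompact_opNorm_le 3).inter_right
    (isClosed_le (continuous_const (y := (d₂ : ℝ) / 2)) h)

-- Both the Ginibre law and the core event are invariant under `G ↦ -G`. Restricting to the core
-- event thus creates no linear terms.
open scoped Matrix.Norms.L2Operator in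
lemma integral_frobInner_coreEvent (A : Fin d₁ → Fin d₂ → ℝ) :
    ∫ G in coreEvent d₁ d₂, frobInner A G ∂(ginibre d₁ d₂) = 0 := by
  have hpre : (fun G : Fin d₁ → Fin d₂ → ℝ => -G) ⁻¹' coreEvent d₁ d₂ = coreEvent d₁ d₂ := by
    ext G
    have h1 : frobInner (-G) (-G) = frobInner G G := by
      rw [frobInner_neg_left, frobInner_neg_right, neg_neg]
    simp only [coreEvent, Set.mem_preimage, Set.mem_ofPred_eq, h1]
    rw [← Matrix.neg_of, norm_neg]
  have h := setIntegral_map (μ := ginibre d₁ d₂) (g := fun G => -G) (f := frobInner A)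
    (measurableSet_coreEvent d₁ d₂) (continuous_frobInner_right A).aestronglyMeasurable
    (by fun_prop)
  rw [map_neg_ginibre, hpre] at h
  simp only [frobInner_neg_right] at h
  rw [integral_neg] at h
  linarith

-- The margins allow a shift of norm `1/10`: `2.9 + 0.1 = 3`, and `(0.9√d₂ - 0.1)² ≥ d₂/2`.
open scoped Matrix.Norms.L2Operator in
lemma add_mem_ginibreEvent (hd₂ : 0 < d₂) {G H : Fin d₁ → Fin d₂ → ℝ} (hG : G ∈ coreEvent d₁ d₂)
    (hH : frobInner H H ≤ 1 / 100) : G + H ∈ ginibreEvent d₁ d₂ := by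
  obtain ⟨h1, h2⟩ := hG
  have hd : (1 : ℝ) ≤ d₂ := by exact_mod_cast hd₂
  constructor
  · rw [← Matrix.of_add_of]
    refine (norm_add_le _ _).trans ?_
    have h3 := opNorm_le_frob H
    have h4 : √(frobInner H H) ≤ 1 / 10 := Real.sqrt_le_iff.mpr ⟨by norm_num, by norm_num; linarith⟩
    linarith
  · have h3 : ∑ i, ∑ j, (G + H) i j ^ 2 = frobInner (G + H) (G + H) := by
      simp [frobInner, pow_two]
    rw [h3, frobInner_add_left, frobInner_add_right, frobInner_add_right, frobInner_comm H G]
    have h4 := frobInner_sq_le G H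
    have h5 := frobInner_self_nonneg H
    set g := √(frobInner G G)
    have hg : g ^ 2 = frobInner G G := Real.sq_sqrt (frobInner_self_nonneg G)
    have hg0 : 0 ≤ g := Real.sqrt_nonneg _
    rw [← hg] at h2 h4 ⊢
    have h6 : |frobInner G H| ≤ g / 10 := by
      refine abs_le_of_sq_le_sq ?_ (by positivity)
      nlinarith [sq_nonneg g]
    have h7 := (abs_le.mp h6).1
    have h8 : 9 / 10 ≤ g := by nlinarith
    nlinarith

lemma exp_le_one_add {y : ℝ} (hy : |y| ≤ 1 / 2) :
    Real.exp (y - y ^ 2 / 2 - 2 * |y| ^ 3) ≤ 1 + y := by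
  have hpos : 0 < 1 + y := by linarith [(abs_le.mp hy).1]
  rw [← Real.le_log_iff_exp_le hpos]
  have h := Real.abs_log_sub_add_sum_range_le (x := -y) (by rw [abs_neg]; linarith) 2
  rw [abs_neg, sub_neg_eq_add] at h
  simp only [Finset.sum_range_succ, Finset.sum_range_zero] at h
  have h2 : |y| ^ (2 + 1) / (1 - |y|) ≤ 2 * |y| ^ 3 := by
    rw [div_le_iff₀ (by linarith)]
    have h3 := mul_nonneg (pow_nonneg (abs_nonneg y) 3) (show 0 ≤ 1 - 2 * |y| by linarith)
    have h4 : |y| ^ (2 + 1) = |y| ^ 3 := rfl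
    rw [h4]
    linarith
  have h3 := (abs_le.mp (h.trans h2)).1
  norm_num at h3
  linarith

/-- The truncated third order expansion of the logarithm at `1`. -/
noncomputable def logLower (y : ℝ) : ℝ := y - y ^ 2 / 2 - 2 * |y| ^ 3

lemma continuous_logLower : Continuous logLower := by unfold logLower; fun_prop

/-- The cube of the random part `g` is split by AM-GM into even powers, whose Gaussian moments are
explicit; `r` balances the split. The cube of the shift `h` is absorbed into `h²`. -/
lemma logLower_add_ge {g h r : ℝ} (hh : |h| ≤ 1 / 16) (hr : 0 < r) :
    h - h ^ 2 + (1 - h) * g - (1 / 2 + 4 / r) * g ^ 2 - 4 * r * g ^ 4 ≤ logLower (g + h) := by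
  unfold logLower
  have h1 : |g + h| ^ 3 ≤ 4 * |g| ^ 3 + 4 * |h| ^ 3 := by
    have h2 : |g + h| ^ 3 ≤ (|g| + |h|) ^ 3 := pow_le_pow_left₀ (abs_nonneg _) (abs_add_le g h) 3
    have h3 : (|g| + |h|) ^ 3 ≤ 4 * |g| ^ 3 + 4 * |h| ^ 3 := by
      have e : 4 * |g| ^ 3 + 4 * |h| ^ 3 - (|g| + |h|) ^ 3
          = 3 * ((|g| + |h|) * (|g| - |h|) ^ 2) := by ring
      have : 0 ≤ (|g| + |h|) * (|g| - |h|) ^ 2 := by positivity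
      linarith
    exact h2.trans h3
  have h4 : 8 * |h| ^ 3 ≤ h ^ 2 / 2 := by
    rw [← sq_abs h]
    nlinarith [sq_nonneg |h|, mul_nonneg (sq_nonneg |h|) (sub_nonneg.mpr hh)]
  have h5 : 8 * |g| ^ 3 ≤ 4 / r * g ^ 2 + 4 * r * g ^ 4 := by
    have e1 : g ^ 2 = |g| ^ 2 := (sq_abs g).symm
    have e2 : g ^ 4 = |g| ^ 4 := by rw [show (4 : ℕ) = 2 * 2 by rfl, pow_mul, e1, ← pow_mul]
    rw [e1, e2]
    have e3 : 4 / r * |g| ^ 2 + 4 * r * |g| ^ 4 - 8 * |g| ^ 3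
        = 4 / r * (|g| - r * |g| ^ 2) ^ 2 := by field_simp; ring
    have : 0 ≤ 4 / r * (|g| - r * |g| ^ 2) ^ 2 := by positivity
    linarith
  nlinarith

/-- The mean on the core event of the contribution of one step to the log-likelihood. -/
lemma setIntegral_logLower_ge (hd : 4 ≤ d₁)
    (hP : 1 - 1 / (d₁ : ℝ) ≤ (ginibre d₁ d₂).real (coreEvent d₁ d₂))
    {A H : Fin d₁ → Fin d₂ → ℝ} (hA : frobInner A A ≤ 1 / 36) (hH : frobInner H H ≤ 1 / 100) :
    (ginibre d₁ d₂).real (coreEvent d₁ d₂) * (frobInner A H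
        - (1 / (2 * d₁) + 7 / (d₁ * √d₁)) * frobInner A A - frobInner A H ^ 2)
      ≤ ∫ G in coreEvent d₁ d₂, logLower (frobInner A (G + H)) ∂(ginibre d₁ d₂) := by
  set γ := ginibre d₁ d₂
  set C := coreEvent d₁ d₂
  set pC := γ.real C
  -- The typical size of `⟨A, G⟩` is `‖A‖/√d₁`, so `r = √d₁` makes both halves of the cubic error of
  -- order `‖A‖²/d₁^(3/2)`.
  set r := √(d₁ : ℝ)
  set h := frobInner A H
  set a := frobInner A A
  have ha : 0 ≤ a := frobInner_self_nonneg A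
  have hd' : (4 : ℝ) ≤ d₁ := by exact_mod_cast hd
  have hdpos : (0 : ℝ) < d₁ := by linarith
  have hr2 : r ^ 2 = d₁ := Real.sq_sqrt hdpos.le
  have hr : 2 ≤ r := Real.le_sqrt_of_sq_le (by norm_num; linarith)
  have hh : |h| ≤ 1 / 16 := by
    refine abs_le_of_sq_le_sq ((frobInner_sq_le A H).trans ?_) (by norm_num)
    nlinarith [frobInner_self_nonneg H]
  have hi : ∀ f : (Fin d₁ → Fin d₂ → ℝ) → ℝ, Continuous f → IntegrableOn f C γ := fun f hf =>
    hf.continuousOn.integrableOn_compact isCompact_coreEvent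
  have hc := continuous_frobInner_right A
  have i1 := hi (fun G => h - h ^ 2) (by fun_prop)
  have i2 := hi (fun G => (1 - h) * frobInner A G) (by fun_prop)
  have i3 := hi (fun G => (1 / 2 + 4 / r) * frobInner A G ^ 2) (by fun_prop)
  have i4 := hi (fun G => 4 * r * frobInner A G ^ 4) (by fun_prop)
  have i12 := hi (fun G => h - h ^ 2 + (1 - h) * frobInner A G) (by fun_prop)
  have i123 := hi (fun G => h - h ^ 2 + (1 - h) * frobInner A G
    - (1 / 2 + 4 / r) * frobInner A G ^ 2) (by fun_prop)
  have h2 : ∫ G in C, frobInner A G ^ 2 ∂γ ≤ a / d₁ := by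
    have e := integral_frobInner_pow_ginibre A 1 one_ne_zero
    simp only [mul_one, pow_one] at e
    refine (setIntegral_le_integral (by simpa using integrable_frobInner_pow_ginibre A 1)
      (Filter.Eventually.of_forall fun G => sq_nonneg _)).trans (le_of_eq ?_)
    rw [e]; norm_num [a]
  have h4 : ∫ G in C, frobInner A G ^ 4 ∂γ ≤ 3 * (a / d₁) ^ 2 := by
    have e := integral_frobInner_pow_ginibre A 2 two_ne_zero
    refine (setIntegral_le_integral (integrable_frobInner_pow_ginibre A 2)
      (Filter.Eventually.of_forall fun G => Even.pow_nonneg ⟨2, rfl⟩ _)).trans (le_of_eq ?_)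
    rw [e]; norm_num [a, Nat.doubleFactorial]; ring
  have hlow : ∫ G in C, (h - h ^ 2 + (1 - h) * frobInner A G
        - (1 / 2 + 4 / r) * frobInner A G ^ 2 - 4 * r * frobInner A G ^ 4) ∂γ
      ≤ ∫ G in C, logLower (frobInner A (G + H)) ∂γ := by
    refine setIntegral_mono (i123.sub i4)
      (hi _ (continuous_logLower.comp (hc.comp (by fun_prop)))) fun G => ?_
    rw [frobInner_add_right]
    exact logLower_add_ge hh (by positivity)
  refine le_trans ?_ hlow
  rw [integral_sub i123 i4, integral_sub i12 i3, integral_add i1 i2,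
    integral_const_mul, integral_const_mul, integral_const_mul, integral_frobInner_coreEvent,
    setIntegral_const, smul_eq_mul]
  have g2 := mul_le_mul_of_nonneg_left h2 (show 0 ≤ 1 / 2 + 4 / r by positivity)
  have g4 := mul_le_mul_of_nonneg_left h4 (show 0 ≤ 4 * r by positivity)
  have g5 : 4 * r * (3 * (a / d₁) ^ 2) ≤ 1 / 3 * (a / (d₁ * r)) := by
    rw [← hr2]
    have e1 : 4 * r * (3 * (a / r ^ 2) ^ 2) = 12 * a * (a / (r ^ 2 * r)) := by
      field_simp; ring
    rw [e1]
    have : 0 ≤ a / (r ^ 2 * r) := by positivity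
    nlinarith
  have g6 : (1 / 2 + 4 / r) * (a / d₁) = a / (2 * d₁) + 4 * (a / (d₁ * r)) := by
    field_simp
  have hp1 : 3 / 4 ≤ pC := by
    have : 1 / (d₁ : ℝ) ≤ 1 / 4 := one_div_le_one_div_of_le (by norm_num) hd'
    linarith
  -- The second moment was bounded over the whole space; replacing `1` by `pC` costs one more error
  -- of order `a/(d₁r)`. Altogether `4 + 1/3 + 1/2 ≤ 21/4 = 7 · 3/4`, whence the constant `7`.
  have g7 : a / (2 * d₁) - 1 / 2 * (a / (d₁ * r)) ≤ pC * (a / (2 * d₁)) := by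
    have e : 1 / (d₁ : ℝ) ≤ 1 / r :=
      one_div_le_one_div_of_le (by positivity) (by rw [← hr2]; nlinarith)
    have e2 : a / (2 * d₁) - 1 / 2 * (a / (d₁ * r)) = (1 - 1 / r) * (a / (2 * d₁)) := by
      field_simp
    rw [e2]
    gcongr
    linarith
  have g8 : 21 / 4 * (a / (d₁ * r)) ≤ pC * (7 * (a / (d₁ * r))) := by
    have : 0 ≤ a / (d₁ * r) := by positivity
    nlinarith
  have g9 : pC * (h - (1 / (2 * d₁) + 7 / (d₁ * r)) * a - h ^ 2)
      = pC * (h - h ^ 2) - pC * (a / (2 * d₁)) - pC * (7 * (a / (d₁ * r))) := by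
    field_simp; ring
  rw [g9]
  have : 0 ≤ a / (d₁ * r) := by positivity
  change _ ≤ pC * (h - h ^ 2) + _ - _ - _
  linarith

lemma continuous_list_sum_comp {X : Type*} [TopologicalSpace X] {V : Type*} (l : List V)
    (f : V → X → ℝ) (hf : ∀ A, Continuous (f A)) : Continuous fun x => (l.map fun A => f A x).sum := by
  induction l with
  | nil => simpa using continuous_const
  | cons A l ih => simp only [List.map_cons, List.sum_cons]; exact (hf A).add ih

lemma continuous_list_prod_comp {X : Type*} [TopologicalSpace X] {V : Type*} (l : List V)
    (f : V → X → ℝ) (hf : ∀ A, Continuous (f A)) :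
    Continuous fun x => (l.map fun A => f A x).prod := by
  induction l with
  | nil => simpa using continuous_const
  | cons A l ih => simp only [List.map_cons, List.prod_cons]; exact (hf A).mul ih

lemma setIntegral_sum_logLower_ge (hd : 4 ≤ d₁)
    (hP : 1 - 1 / (d₁ : ℝ) ≤ (ginibre d₁ d₂).real (coreEvent d₁ d₂))
    (l : List (Fin d₁ → Fin d₂ → ℝ)) (hl : ∀ A ∈ l, frobInner A A ≤ 1 / 36)
    {H : Fin d₁ → Fin d₂ → ℝ} (hH : frobInner H H ≤ 1 / 100) :
    (ginibre d₁ d₂).real (coreEvent d₁ d₂) * (listLin l H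
        - (1 / (2 * d₁) + 7 / (d₁ * √d₁)) * listSq l - listQuad l H)
      ≤ ∫ G in coreEvent d₁ d₂, (l.map fun A => logLower (frobInner A (G + H))).sum
        ∂(ginibre d₁ d₂) := by
  induction l with
  | nil => simp [listLin, listSq, listQuad]
  | cons A l ih =>
    have h1 := setIntegral_logLower_ge hd hP (hl A (by simp)) hH
    have h2 := ih fun B hB => hl B (by simp [hB])
    have hc : ∀ B : Fin d₁ → Fin d₂ → ℝ, Continuous fun G => logLower (frobInner B (G + H)) :=
      fun B => continuous_logLower.comp ((continuous_frobInner_right B).comp (by fun_prop))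
    simp only [listLin, listSq, listQuad, List.map_cons, List.sum_cons] at h2 ⊢
    rw [integral_add ((hc A).continuousOn.integrableOn_compact isCompact_coreEvent)
      ((continuous_list_sum_comp l _ hc).continuousOn.integrableOn_compact isCompact_coreEvent)]
    linarith

lemma exp_sum_logLower_le_prod {V : Type*} (l : List V) (y : V → ℝ) (hy : ∀ A ∈ l, |y A| ≤ 1 / 2) :
    Real.exp ((l.map fun A => logLower (y A)).sum) ≤ (l.map fun A => 1 + y A).prod := by
  induction l with
  | nil => simp
  | cons A l ih =>
    have h1 := exp_le_one_add (hy A (by simp))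
    have h2 := ih fun B hB => hy B (by simp [hB])
    simp only [List.map_cons, List.sum_cons, List.prod_cons, Real.exp_add]
    exact mul_le_mul h1 h2 (Real.exp_pos _).le ((Real.exp_pos _).le.trans h1)

/-- The Ginibre law of an event of the truncated form is at least that of its shifted part. -/
lemma setIntegral_ginibreEvent_ge (hd₁ : 0 < d₁) (hd₂ : 0 < d₂)
    {f F : (Fin d₁ → Fin d₂ → ℝ) → ℝ} (hf : Continuous f) (hF : Continuous F)
    {H : Fin d₁ → Fin d₂ → ℝ} (hH : frobInner H H ≤ 1 / 100)
    (h : ∀ G ∈ coreEvent d₁ d₂, Real.exp (F G) ≤ f (G + H)) (hf0 : ∀ G ∈ ginibreEvent d₁ d₂, 0 ≤ f G) :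
    ∫ G in coreEvent d₁ d₂, Real.exp (F G - d₁ * frobInner H G - d₁ * frobInner H H / 2)
        ∂(ginibre d₁ d₂)
      ≤ ∫ G in ginibreEvent d₁ d₂, f G ∂(ginibre d₁ d₂) := by
  set γ := ginibre d₁ d₂
  set C := coreEvent d₁ d₂
  set E := ginibreEvent d₁ d₂
  have hE := measurableSet_ginibreEvent d₁ d₂
  have hC := measurableSet_coreEvent d₁ d₂
  have hcH := continuous_frobInner_right H
  have iE : IntegrableOn f E γ := hf.continuousOn.integrableOn_compact isCompact_ginibreEvent
  have iC : IntegrableOn (fun G => Real.exp (F G - d₁ * frobInner H G - d₁ * frobInner H H / 2))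
      C γ := by
    refine Continuous.continuousOn ?_ |>.integrableOn_compact isCompact_coreEvent
    fun_prop
  have hE0 : 0 ≤ ∫ G in E, f G ∂γ := setIntegral_nonneg hE hf0
  rw [← ENNReal.ofReal_le_ofReal_iff hE0, ofReal_integral_eq_lintegral_ofReal iE
    ((ae_restrict_mem hE).mono hf0), ofReal_integral_eq_lintegral_ofReal iC
    (Filter.Eventually.of_forall fun G => (Real.exp_pos _).le)]
  set ρ : (Fin d₁ → Fin d₂ → ℝ) → ℝ := fun G => d₁ * frobInner H G - d₁ * frobInner H H / 2
  have hρ : Continuous ρ := by fun_prop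
  have hρm : Measurable fun G => ENNReal.ofReal (Real.exp (ρ G)) :=
    ENNReal.measurable_ofReal.comp (Real.continuous_exp.comp hρ).measurable
  -- Dividing by the Cameron-Martin density in advance makes it cancel after the shift.
  set ψ : (Fin d₁ → Fin d₂ → ℝ) → ℝ≥0∞ :=
    E.indicator fun G => ENNReal.ofReal (f G * Real.exp (-ρ G))
  have hψ : Measurable ψ := (ENNReal.measurable_ofReal.comp
    (hf.mul (Real.continuous_exp.comp hρ.neg)).measurable).indicator hE
  calc ∫⁻ G in C, ENNReal.ofReal (Real.exp (F G - d₁ * frobInner H G - d₁ * frobInner H H / 2)) ∂γ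
      ≤ ∫⁻ G in C, ψ (G + H) ∂γ := by
        refine setLIntegral_mono' hC fun G hG => ?_
        simp only [ψ]
        rw [Set.indicator_of_mem (add_mem_ginibreEvent hd₂ hG hH)]
        refine ENNReal.ofReal_le_ofReal ?_
        have e : F G - d₁ * frobInner H G - d₁ * frobInner H H / 2 = F G + -ρ (G + H) := by
          simp only [ρ, frobInner_add_right]; ring
        rw [e, Real.exp_add]
        exact mul_le_mul_of_nonneg_right (h G hG) (Real.exp_pos _).le
    _ ≤ ∫⁻ G, ψ (G + H) ∂γ := setLIntegral_le_lintegral _ _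
    _ = ∫⁻ G, ψ G ∂(γ.map fun G => G + H) := (lintegral_map hψ (by fun_prop)).symm
    _ = ∫⁻ G, ENNReal.ofReal (Real.exp (ρ G)) * ψ G ∂γ := by
        rw [map_add_ginibre hd₁, lintegral_withDensity_eq_lintegral_mul _ hρm hψ]
        rfl
    _ = ∫⁻ G, E.indicator (fun G => ENNReal.ofReal (f G)) G ∂γ := by
        refine lintegral_congr fun G => ?_
        by_cases hG : G ∈ E
        · simp only [ψ, Set.indicator_of_mem hG]
          rw [← ENNReal.ofReal_mul (Real.exp_pos _).le, mul_left_comm, ← Real.exp_add]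
          simp
        · simp [ψ, Set.indicator_of_notMem hG]
    _ = ∫⁻ G in E, ENNReal.ofReal (f G) ∂γ := lintegral_indicator hE _

lemma one_sub_inv_ge_exp {x : ℝ} (hx : 2 ≤ x) : Real.exp (-(2 / x)) ≤ 1 - 1 / x := by
  have h1 := Real.add_one_le_exp (2 / x)
  rw [Real.exp_neg]
  have hx0 : 0 < x := by linarith
  have h2 : (1 - 1 / x) * (2 / x + 1) = 1 + (x - 2) / x ^ 2 := by field_simp; ring
  have h3 : 0 ≤ (x - 2) / x ^ 2 := div_nonneg (by linarith) (by positivity)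
  have h4 : 0 ≤ 1 - 1 / x := by
    have : 1 / x ≤ 1 := by rw [div_le_one hx0]; linarith
    linarith
  rw [inv_le_iff_one_le_mul₀ (Real.exp_pos _)]
  nlinarith

/-- Lower bound on the likelihood ratio: Jensen's inequality after a shift by `H`. -/
lemma exp_logLikelihood_le (hd : 4 ≤ d₁) (hd₂ : 0 < d₂)
    (hP : 1 - 1 / (d₁ : ℝ) ≤ (ginibre d₁ d₂).real (coreEvent d₁ d₂))
    (l : List (Fin d₁ → Fin d₂ → ℝ)) (hl : ∀ A ∈ l, frobInner A A ≤ 1 / 36)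
    (hlE : ∀ A ∈ l, ∀ G ∈ ginibreEvent d₁ d₂, |frobInner A G| ≤ 1 / 2)
    {H : Fin d₁ → Fin d₂ → ℝ} (hH : frobInner H H ≤ 1 / 100) :
    Real.exp (-(2 / d₁) + (listLin l H - d₁ * frobInner H H / 2
        - (1 / (2 * d₁) + 7 / (d₁ * √d₁)) * listSq l - listQuad l H))
      ≤ ∫ G, (l.map fun A => 1 + frobInner A G).prod ∂(truncatedGinibre d₁ d₂) := by
  set γ := ginibre d₁ d₂
  set C := coreEvent d₁ d₂
  set E := ginibreEvent d₁ d₂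
  set pC := γ.real C
  set M := listLin l H - d₁ * frobInner H H / 2
        - (1 / (2 * d₁) + 7 / (d₁ * √d₁)) * listSq l - listQuad l H with hM
  have hd' : (4 : ℝ) ≤ d₁ := by exact_mod_cast hd
  set f : (Fin d₁ → Fin d₂ → ℝ) → ℝ := fun G => (l.map fun A => 1 + frobInner A G).prod
  set F : (Fin d₁ → Fin d₂ → ℝ) → ℝ :=
    fun G => (l.map fun A => logLower (frobInner A (G + H))).sum
  have hc : ∀ B : Fin d₁ → Fin d₂ → ℝ, Continuous fun G => logLower (frobInner B (G + H)) :=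
    fun B => continuous_logLower.comp ((continuous_frobInner_right B).comp (by fun_prop))
  have hF : Continuous F := continuous_list_sum_comp l _ hc
  have hf : Continuous f := continuous_list_prod_comp l _ fun A =>
    continuous_const.add (continuous_frobInner_right A)
  have hpos : ∀ G ∈ E, 0 ≤ f G := fun G hG => List.prod_nonneg fun x hx => by
    obtain ⟨A, hA, rfl⟩ := List.mem_map.mp hx
    linarith [(abs_le.mp (hlE A hA G hG)).1]
  have h1 := setIntegral_ginibreEvent_ge (by omega) hd₂ hf hF hH
    (fun G hG => exp_sum_logLower_le_prod l (fun A => frobInner A (G + H)) fun A hA =>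
      hlE A hA _ (add_mem_ginibreEvent hd₂ hG hH)) hpos
  have h2 := setIntegral_sum_logLower_ge hd hP l hl hH
  have hcH := continuous_frobInner_right H
  set W : (Fin d₁ → Fin d₂ → ℝ) → ℝ := fun G => F G - d₁ * frobInner H G - d₁ * frobInner H H / 2
  have hW : Continuous W := by fun_prop
  have hi : ∀ f : (Fin d₁ → Fin d₂ → ℝ) → ℝ, Continuous f → IntegrableOn f C γ := fun f hf =>
    hf.continuousOn.integrableOn_compact isCompact_coreEvent
  have h3 : pC * M ≤ ∫ G in C, W G ∂γ := by
    change _ ≤ ∫ G in C, (F G - d₁ * frobInner H G - d₁ * frobInner H H / 2) ∂γ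
    rw [integral_sub (hi (fun G => F G - d₁ * frobInner H G) (by fun_prop))
      (hi (fun G => d₁ * frobInner H H / 2) (by fun_prop)),
      integral_sub (hi F hF) (hi (fun G => d₁ * frobInner H G) (by fun_prop)), integral_const_mul,
      integral_frobInner_coreEvent, setIntegral_const, smul_eq_mul, hM]
    change _ ≤ _ - _ - pC * _
    linarith
  have h4 : pC * Real.exp M ≤ ∫ G in C, Real.exp (W G) ∂γ := by
    -- Jensen by the tangent line of `exp` at `M`, without normalising the restricted measure.
    have h5 : ∫ G in C, Real.exp M * (W G + (1 - M)) ∂γ ≤ ∫ G in C, Real.exp (W G) ∂γ := by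
      refine setIntegral_mono (hi _ (by fun_prop)) (hi _ (by fun_prop)) fun G => ?_
      have h6 := Real.add_one_le_exp (W G - M)
      calc Real.exp M * (W G + (1 - M)) ≤ Real.exp M * Real.exp (W G - M) := by
            gcongr; linarith
        _ = Real.exp (W G) := by rw [← Real.exp_add]; ring_nf
    rw [integral_const_mul, integral_add (hi W hW) (hi (fun _ => 1 - M) continuous_const),
      setIntegral_const, smul_eq_mul] at h5
    refine le_trans ?_ h5
    change _ ≤ _ * (_ + pC * (1 - M))
    nlinarith [Real.exp_pos M]
  have hpE : 0 < γ.real E := by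
    have hCE : C ⊆ E := fun G hG => by
      have := add_mem_ginibreEvent hd₂ hG (H := 0) (by simp [frobInner])
      simpa using this
    have : pC ≤ γ.real E := measureReal_mono hCE
    have h6 : 1 / (d₁ : ℝ) ≤ 1 / 4 := one_div_le_one_div_of_le (by norm_num) hd'
    linarith
  have h7 : ∫ G, f G ∂(truncatedGinibre d₁ d₂) = (γ.real E)⁻¹ * ∫ G in E, f G ∂γ := by
    unfold truncatedGinibre ProbabilityTheory.cond
    rw [integral_smul_measure, ENNReal.toReal_inv, smul_eq_mul]
    rfl
  have h8 : 0 ≤ ∫ G in E, f G ∂γ := setIntegral_nonneg (measurableSet_ginibreEvent _ _) hpos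
  -- The normalisation by the conditioning only helps, since `f` is nonnegative on `E`.
  have h9 : ∫ G in E, f G ∂γ ≤ (γ.real E)⁻¹ * ∫ G in E, f G ∂γ :=
    le_mul_of_one_le_left h8 (one_le_inv_iff₀.mpr ⟨hpE, measureReal_le_one⟩)
  rw [h7]
  refine le_trans ?_ h9
  refine le_trans ?_ (h4.trans h1)
  rw [Real.exp_add]
  have := one_sub_inv_ge_exp (x := d₁) (by linarith)
  gcongr
  exact this.trans hP

end Likelihood

/-! ### Leaves as histories, and the testing inequality. -/

section Testing

variable {Z : Type*}

/-- The probability of a history (the latest outcome first). -/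
def pathProb (κ : List Z → Z → ℝ) : List Z → ℝ
  | [] => 1
  | z :: h => κ h z * pathProb κ h

lemma pathProb_nonneg {κ : List Z → Z → ℝ} (hκ : ∀ h z, 0 ≤ κ h z) (h : List Z) :
    0 ≤ pathProb κ h := by
  induction h with
  | nil => exact zero_le_one
  | cons z h ih => exact mul_nonneg (hκ h z) ih

lemma pathProb_eq_mul_prod {m n : Type*} [Fintype m] [Fintype n] {κ κ' : List Z → Z → ℝ}
    (K : List Z → Z → m → n → ℝ) (G : m → n → ℝ)
    (hκ : ∀ h z, κ' h z = κ h z * (1 + frobInner (K h z) G)) (h : List Z) :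
    pathProb κ' h = pathProb κ h * ((scoreList K h).map fun A => 1 + frobInner A G).prod := by
  induction h with
  | nil => simp [pathProb, scoreList]
  | cons z h ih =>
    simp only [pathProb, scoreList, List.map_cons, List.prod_cons, ih, hκ]
    ring

lemma reverse_ofFn_snoc {t : ℕ} (y : Fin t → Z) (z : Z) :
    (List.ofFn (Fin.snoc y z : Fin (t + 1) → Z)).reverse = z :: (List.ofFn y).reverse := by
  rw [List.ofFn_succ']
  simp [List.concat_eq_append]

/-- This converts sums over leaves into iterated conditional means. Histories list the latest
outcome first, hence the reversal. -/
lemma sum_pathProb_mul [Fintype Z] (κ : List Z → Z → ℝ) (t : ℕ) (f : List Z → ℝ) :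
    ∑ x : Fin t → Z, pathProb κ (List.ofFn x).reverse * f (List.ofFn x).reverse
      = treeMean κ t f := by
  induction t generalizing f with
  | zero => simp [treeMean, pathProb]
  | succ t ih =>
    rw [← (Fin.snocEquiv fun _ => Z).sum_comp, Fintype.sum_prod_type, Finset.sum_comm, treeMean,
      ← ih]
    refine Finset.sum_congr rfl fun y _ => ?_
    rw [Finset.mul_sum]
    refine Finset.sum_congr rfl fun z _ => ?_
    have e : (Fin.snocEquiv fun _ => Z) (z, y) = (Fin.snoc y z : Fin (t + 1) → Z) := rfl
    rw [e, reverse_ofFn_snoc, pathProb]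
    ring

variable {ι : Type*} [Fintype ι] [DecidableEq ι] {n : ℕ}

/-- The measurement made by a learning tree after a history (the latest outcome first). -/
def LearningTree.povmAt (T : LearningTree ι n) (h : List (Fin T.k)) (hh : h.length < n) :
    POVM ι (Fin T.k) :=
  T.povm ⟨h.length, hh⟩ fun s => h.reverse.get (s.cast (by simp))

/-- The transition probabilities of a learning tree. -/
noncomputable def LearningTree.kernel (T : LearningTree ι n) (ρ : Matrix ι ι ℂ)
    (h : List (Fin T.k)) (z : Fin T.k) : ℝ :=
  -- Past depth `n` there is no measurement and the kernel is zero; hence the restriction `h.length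
  -- < N` in `IsCentredWalk`.
  if hh : h.length < n then (T.povmAt h hh).prob ρ z else 0

lemma LearningTree.povmAt_reverse_ofFn (T : LearningTree ι n) {t : ℕ} (ht : t < n)
    (y : Fin t → Fin T.k) (h : List (Fin T.k)) (hy : h = (List.ofFn y).reverse)
    (hh : h.length < n) : T.povmAt h hh = T.povm ⟨t, ht⟩ y := by
  have hlen : h.length = t := by simp [hy]
  subst hlen
  unfold povmAt
  congr 1
  funext s
  have : h.reverse = List.ofFn y := by simpa using congrArg List.reverse hy
  simp [this]

lemma LearningTree.prod_prob_eq_pathProb (T : LearningTree ι n) (ρ : Matrix ι ι ℂ) (t : ℕ)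
    (ht : t ≤ n) (x : Fin t → Fin T.k) :
    ∏ i : Fin t, (T.povm (i.castLE ht) fun s => x (Fin.castLE i.isLt.le s)).prob ρ (x i)
      = pathProb (T.kernel ρ) (List.ofFn x).reverse := by
  induction t with
  | zero => simp [pathProb]
  | succ t ih =>
    obtain ⟨⟨z, y⟩, rfl⟩ := (Fin.snocEquiv fun _ => Fin T.k).surjective x
    have e : (Fin.snocEquiv fun _ => Fin T.k) (z, y) = (Fin.snoc y z : Fin (t + 1) → Fin T.k) := rfl
    rw [e, reverse_ofFn_snoc, pathProb, ← ih (by omega) y, Fin.prod_univ_castSucc, mul_comm]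
    have hl : (List.ofFn y).reverse.length < n := by simp; omega
    congr 1
    · rw [kernel, dif_pos hl, T.povmAt_reverse_ofFn (by omega) y _ rfl hl, Fin.snoc_last]
      congr 2
      funext s
      exact Fin.snoc_castSucc (α := fun _ => Fin T.k) z y s
    · refine Finset.prod_congr rfl fun i _ => ?_
      rw [Fin.snoc_castSucc]
      congr 2
      funext s
      exact Fin.snoc_castSucc (α := fun _ => Fin T.k) z y (Fin.castLE i.isLt.le s)

lemma LearningTree.leafProb_eq_pathProb (T : LearningTree ι n) (ρ : Matrix ι ι ℂ) (x : T.Leaf) :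
    T.leafProb ρ x = pathProb (T.kernel ρ) (List.ofFn x).reverse :=
  T.prod_prob_eq_pathProb ρ n le_rfl x

/-- If the log-likelihood ratio of `P₁` to `P₀` is at least `ℓ`, and `ℓ` has mean at least `-δ`
under `P₀`, then a test whose two errors have sum at most `1 - η` exists only if `η² ≤ δ`. -/
lemma sq_le_of_test {X : Type*} [Fintype X] (P₀ P₁ ℓ : X → ℝ) (A : X → Bool) {p δ : ℝ}
    (hp : 1 / 2 < p) (h₀ : ∀ x, 0 ≤ P₀ x) (hs₀ : ∑ x, P₀ x = 1) (hs₁ : ∑ x, P₁ x ≤ 1)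
    (hℓ : ∀ x, P₀ x * Real.exp (ℓ x) ≤ P₁ x) (hm : -δ ≤ ∑ x, P₀ x * ℓ x)
    (hf : p ≤ ∑ x with A x = false, P₀ x) (ht : p ≤ ∑ x with A x = true, P₁ x) :
    (2 * p - 1) ^ 2 ≤ δ := by
  set v := 2 * p with hv
  have hv1 : 1 < v := by linarith
  -- The Bhattacharyya affinity `√(P₀ P₁)` lies in between, up to the minorant `ℓ`; the weight `u`
  -- is free to differ between the two answers.
  have hpt : ∀ x (u : ℝ), 0 < u → P₀ x * (1 + ℓ x / 2) ≤ (u * P₀ x + u⁻¹ * P₁ x) / 2 := by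
    intro x u hu
    have e1 : 1 + ℓ x / 2 ≤ Real.exp (ℓ x / 2) := by linarith [Real.add_one_le_exp (ℓ x / 2)]
    have e2 : Real.exp (ℓ x / 2) ≤ (u + u⁻¹ * Real.exp (ℓ x)) / 2 := by
      have e3 : Real.exp (ℓ x) = Real.exp (ℓ x / 2) ^ 2 := by
        rw [← Real.exp_nat_mul]; congr 1; push_cast; ring
      rw [e3]
      have e4 : (u + u⁻¹ * Real.exp (ℓ x / 2) ^ 2) / 2 - Real.exp (ℓ x / 2)
          = u⁻¹ * (u - Real.exp (ℓ x / 2)) ^ 2 / 2 := by field_simp; ring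
      have : 0 ≤ u⁻¹ * (u - Real.exp (ℓ x / 2)) ^ 2 / 2 := by positivity
      linarith
    have e5 := mul_le_mul_of_nonneg_left (e1.trans e2) (h₀ x)
    have e6 := mul_le_mul_of_nonneg_left (hℓ x) (inv_pos.mpr hu).le
    nlinarith
  have hsplit : ∀ f : X → ℝ, ∑ x, f x = ∑ x with A x = false, f x + ∑ x with A x = true, f x :=
    fun f => by
      rw [← Finset.sum_filter_add_sum_filter_not Finset.univ (fun x => A x = false) f]
      simp
  have hsum : ∑ x, P₀ x * (1 + ℓ x / 2) = 1 + (∑ x, P₀ x * ℓ x) / 2 := by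
    simp only [mul_add, mul_one, Finset.sum_add_distrib, hs₀, Finset.sum_div, mul_div_assoc]
  rw [hsplit] at hsum hs₀ hs₁
  have b1 : ∑ x with A x = false, P₀ x * (1 + ℓ x / 2)
      ≤ (v⁻¹ * ∑ x with A x = false, P₀ x + v * ∑ x with A x = false, P₁ x) / 2 := by
    rw [Finset.mul_sum, Finset.mul_sum, ← Finset.sum_add_distrib, Finset.sum_div]
    refine Finset.sum_le_sum fun x _ => ?_
    simpa using hpt x v⁻¹ (by positivity)
  have b2 : ∑ x with A x = true, P₀ x * (1 + ℓ x / 2)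
      ≤ (v * ∑ x with A x = true, P₀ x + v⁻¹ * ∑ x with A x = true, P₁ x) / 2 := by
    rw [Finset.mul_sum, Finset.mul_sum, ← Finset.sum_add_distrib, Finset.sum_div]
    exact Finset.sum_le_sum fun x _ => hpt x v (by positivity)
  set a := ∑ x with A x = false, P₀ x
  set b := ∑ x with A x = true, P₁ x
  have hvi : v⁻¹ ≤ 1 := inv_le_one_of_one_le₀ hv1.le
  have b3 : v⁻¹ * a + v * ∑ x with A x = false, P₁ x ≤ v⁻¹ * a + v * (1 - b) := by
    have : ∑ x with A x = false, P₁ x ≤ 1 - b := by linarith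
    gcongr
  have b4 : v * ∑ x with A x = true, P₀ x + v⁻¹ * b = v * (1 - a) + v⁻¹ * b := by
    have : ∑ x with A x = true, P₀ x = 1 - a := by linarith
    rw [this]
  -- With weights `v⁻¹` and `v`, the left side is `2v - (v - v⁻¹)(a + b)`. It decreases in `a + b`,
  -- which is at least `v = 2p`.
  have b5 : v⁻¹ * a + v * (1 - b) + (v * (1 - a) + v⁻¹ * b) ≤ 2 - (v - 1) ^ 2 := by
    have e : v⁻¹ * v = 1 := inv_mul_cancel₀ (by positivity)
    have e2 : v ≤ a + b := by linarith
    have e3 : 0 ≤ (v - v⁻¹) * (a + b - v) := mul_nonneg (by linarith) (by linarith)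
    nlinarith
  linarith

end Testing

/-! ### Application to learning trees. -/

section Main

/-- The matrices attached to the steps of a learning tree. -/
noncomputable def LearningTree.scoreAt {d₁ d₂ n : ℕ} (T : LearningTree (Fin d₁ ⊕ Fin d₂) n)
    (α : Fin d₁ → ℝ) (β : Fin d₂ → ℝ) (ε : ℝ) (h : List (Fin T.k)) (z : Fin T.k) :
    Fin d₁ → Fin d₂ → ℝ :=
  if hh : h.length < n then (T.povmAt h hh).score α β ε z else 0

variable {d₁ d₂ n : ℕ} (T : LearningTree (Fin d₁ ⊕ Fin d₂) n) {α : Fin d₁ → ℝ} {β : Fin d₂ → ℝ}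
  {a b ε : ℝ}

lemma LearningTree.isCentredWalk (ha : 0 < a) (hb : 0 < b) (hα : ∀ i, a ≤ α i)
    (hβ : ∀ j, b ≤ β j) (h1 : ∑ i, α i + ∑ j, β j = 1) (hε : 0 ≤ ε)
    (hs : 6 * (ε / d₂) ≤ √(a * b)) :
    IsCentredWalk (T.kernel (nullState α β)) (T.scoreAt α β ε) n (4 * (ε / d₂) ^ 2 / b) d₁ where
  nonneg h z := by
    unfold kernel
    split_ifs with hh
    · exact (T.povmAt h hh).prob_nullState_nonneg ha hb hα hβ z
    · exact le_rfl
  q_nonneg := by positivity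
  D_nonneg := Nat.cast_nonneg _
  sum_one h hh := by
    simp only [kernel, dif_pos hh]
    exact (T.povmAt h hh).sum_prob_nullState h1
  mean_zero h hh H := by
    simp only [kernel, scoreAt, dif_pos hh]
    exact (T.povmAt h hh).sum_prob_mul_frobInner_score ha hb hα hβ H
  mean_sq h hh := by
    simp only [kernel, scoreAt, dif_pos hh]
    exact (T.povmAt h hh).sum_prob_mul_frobInner_score_self_le ha hb hα hβ
  cov h hh H := by
    simp only [kernel, scoreAt, dif_pos hh]
    exact (T.povmAt h hh).sum_prob_mul_frobInner_score_sq_le ha hb hα hβ H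
  bdd h z hh := by
    simp only [scoreAt, dif_pos hh]
    exact (T.povmAt h hh).frobInner_score_self_le ha hb hα hβ hε hs z

lemma LearningTree.kernel_altState (ha : 0 < a) (hb : 0 < b) (hα : ∀ i, a ≤ α i)
    (hβ : ∀ j, b ≤ β j) (G : Fin d₁ → Fin d₂ → ℝ) (h : List (Fin T.k)) (z : Fin T.k) :
    T.kernel (altState α β ε G) h z
      = T.kernel (nullState α β) h z * (1 + frobInner (T.scoreAt α β ε h z) G) := by
  unfold kernel scoreAt
  split_ifs with hh
  · rw [(T.povmAt h hh).prob_altState_eq_mul ha hb hα hβ, frobInner_comm]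
  · simp

lemma LearningTree.sum_leafProb_altState (h1 : ∑ i, α i + ∑ j, β j = 1)
    (G : Fin d₁ → Fin d₂ → ℝ) : ∑ x, T.leafProb (altState α β ε G) x = 1 := by
  have h := sum_pathProb_mul (T.kernel (altState α β ε G)) n (fun _ => 1)
  -- For `G` outside the truncation event the alternative need not be a state and its kernel may be
  -- negative. So `treeMean_const` does not apply, and the identity is obtained from normalisation
  -- alone.
  have hone : ∀ t ≤ n, treeMean (T.kernel (altState α β ε G)) t (fun _ => 1) = 1 := by
    intro t ht
    induction t with
    | zero => rfl
    | succ t ih =>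
      have : ∀ f g : List (Fin T.k) → ℝ, (∀ h, h.length = t → f h = g h) →
          treeMean (T.kernel (altState α β ε G)) t f
            = treeMean (T.kernel (altState α β ε G)) t g := by
        intro f g hfg
        rw [← sum_pathProb_mul, ← sum_pathProb_mul]
        exact Finset.sum_congr rfl fun x _ => by rw [hfg _ (by simp)]
      refine (this _ (fun _ => 1) fun h hh => ?_).trans (ih (by omega))
      have hh' : h.length < n := by omega
      simp only [kernel, dif_pos hh', mul_one]
      exact (T.povmAt h hh').sum_prob_altState h1 G
  rw [hone n le_rfl] at h
  simp only [mul_one] at h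
  simpa only [T.leafProb_eq_pathProb] using h

lemma forall_mem_scoreList {Z : Type*} {m n' : Type*} {K : List Z → Z → m → n' → ℝ}
    {p : (m → n' → ℝ) → Prop} {N : ℕ} (hK : ∀ h z, h.length < N → p (K h z)) (h : List Z)
    (hh : h.length ≤ N) : ∀ A ∈ scoreList K h, p A := by
  induction h with
  | nil => simp [scoreList]
  | cons z h ih =>
    simp only [List.length_cons] at hh
    simp only [scoreList, List.mem_cons, forall_eq_or_imp]
    exact ⟨hK h z (by omega), ih (by omega)⟩

/-- The likelihood ratio test for a learning tree of small depth. -/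
lemma LearningTree.sq_le_of_canDistinguish (hd : 4 ≤ d₁) (hd₂ : 0 < d₂)
    (hP : 1 - 1 / (d₁ : ℝ) ≤ (ginibre d₁ d₂).real (coreEvent d₁ d₂))
    (ha : 0 < a) (hb : 0 < b) (hα : ∀ i, a ≤ α i)
    (hβ : ∀ j, b ≤ β j) (h1 : ∑ i, α i + ∑ j, β j = 1) (hε : 0 ≤ ε)
    (hs : 6 * (ε / d₂) ≤ √(a * b)) {p : ℝ} (hp : 1 / 2 < p)
    (hcd : CanDistinguish (nullState α β) (truncatedGinibre d₁ d₂) (altState α β ε) p n)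
    {q : ℝ} (hq : q = 4 * (ε / d₂) ^ 2 / b) :
    (2 * p - 1) ^ 2 ≤ 2 / d₁ + (200 * (n * q) ^ 2 / d₁ + 7 / (d₁ * √d₁) * (n * (q * d₁))
      + (3 * (n * q) ^ 2 + n * q) / d₁) := by
  obtain ⟨T, A, hf, ht⟩ := hcd
  have P := T.isCentredWalk ha hb hα hβ h1 hε hs
  rw [← hq] at P
  have hdpos : (0 : ℝ) < d₁ := by positivity
  set κ := T.kernel (nullState α β)
  set K := T.scoreAt α β ε
  set S := fun h => (d₁ : ℝ)⁻¹ • stoppedSum K (d₁ / 20) h with hS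
  set L : List (Fin T.k) → ℝ := fun h => -(2 / (d₁ : ℝ))
        + (listLin (scoreList K h) (S h) - d₁ * frobInner (S h) (S h) / 2
        - (1 / (2 * d₁) + 7 / (d₁ * √d₁)) * listSq (scoreList K h)
        - listQuad (scoreList K h) (S h)) with hL
  have hmean := P.treeMean_logLikelihood_ge hdpos (-(2 / (d₁ : ℝ)))
    (e := 7 / (d₁ * √d₁)) (by positivity)
  have hprod : ∀ G, ∀ x : T.Leaf, T.leafProb (altState α β ε G) x
      = T.leafProb (nullState α β) x
        * ((scoreList K (List.ofFn x).reverse).map fun A => 1 + frobInner A G).prod := by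
    intro G x
    rw [T.leafProb_eq_pathProb, T.leafProb_eq_pathProb]
    exact pathProb_eq_mul_prod K G (T.kernel_altState ha hb hα hβ G) _
  have h0 : ∀ x : T.Leaf, 0 ≤ T.leafProb (nullState α β) x := fun x => by
    rw [T.leafProb_eq_pathProb]; exact pathProb_nonneg P.nonneg _
  refine sq_le_of_test (fun x => T.leafProb (nullState α β) x)
    (fun x => T.mixtureLeafProb (truncatedGinibre d₁ d₂) (altState α β ε) x)
    (fun x => L (List.ofFn x).reverse) A hp h0 ?_ ?_ ?_ ?_ hf ht
  · have h := sum_pathProb_mul κ n (fun _ => 1)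
    rw [treeMean_const n P.sum_one _ P.nonneg] at h
    simp only [mul_one] at h
    simpa only [T.leafProb_eq_pathProb] using h
  · have hint : ∀ x : T.Leaf, Integrable (fun G => T.leafProb (altState α β ε G) x)
        (truncatedGinibre d₁ d₂) := by
      intro x
      simp only [hprod]
      have hc : Continuous fun G : Fin d₁ → Fin d₂ → ℝ => T.leafProb (nullState α β) x
          * ((scoreList K (List.ofFn x).reverse).map fun A => 1 + frobInner A G).prod :=
        continuous_const.mul (continuous_list_prod_comp _ _ fun A =>
          continuous_const.add (continuous_frobInner_right A))
      have hE : (ginibre d₁ d₂ (ginibreEvent d₁ d₂))⁻¹ ≠ ⊤ := by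
        rw [ENNReal.inv_ne_top]
        intro h0
        have hCE : coreEvent d₁ d₂ ⊆ ginibreEvent d₁ d₂ := fun G hG => by
          simpa using add_mem_ginibreEvent hd₂ hG (H := 0) (by simp [frobInner])
        have h2 := measure_mono_null hCE h0
        rw [measureReal_def, h2, ENNReal.toReal_zero] at hP
        have hd' : (4 : ℝ) ≤ d₁ := by exact_mod_cast hd
        have h3 : 1 / (d₁ : ℝ) ≤ 1 / 4 := one_div_le_one_div_of_le (by norm_num) hd'
        linarith
      exact Integrable.smul_measure
        (hc.continuousOn.integrableOn_compact isCompact_ginibreEvent) hE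
    simp only [mixtureLeafProb]
    rw [← integral_finsetSum _ fun x _ => hint x]
    simp only [T.sum_leafProb_altState h1]
    have : IsZeroOrProbabilityMeasure (truncatedGinibre d₁ d₂) := by
      unfold truncatedGinibre; infer_instance
    rw [integral_const, smul_eq_mul, mul_one]
    exact measureReal_le_one
  · intro x
    have hlen : (List.ofFn x).reverse.length ≤ n := by simp
    simp only [mixtureLeafProb, hprod]
    rw [integral_const_mul]
    refine mul_le_mul_of_nonneg_left ?_ (h0 x)
    refine exp_logLikelihood_le hd hd₂ hP _
      (forall_mem_scoreList (p := fun A => frobInner A A ≤ 1 / 36) P.bdd _ hlen)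
      (forall_mem_scoreList (p := fun A => ∀ G ∈ ginibreEvent d₁ d₂, |frobInner A G| ≤ 1 / 2)
        (fun h z hh G hG => ?_) _ hlen) ?_
    · simp only [K, scoreAt, dif_pos hh]
      rw [frobInner_comm]
      exact (T.povmAt h hh).abs_frobInner_score_le ha hb hα hβ hε hs z G hG.1
    · have hd' : (4 : ℝ) ≤ d₁ := by exact_mod_cast hd
      -- The stopped sum has norm at most `d₁/10`, so the shift has norm at most `1/10`; `d₁ ≥ 4`
      -- ensures `d₁/20 ≥ 1/6`.
      have h2 := P.frobInner_stoppedSum_le (R := (d₁ : ℝ) / 20) (by linarith) _ hlen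
      rw [hS]
      simp only [frobInner_smul_left, frobInner_smul_right]
      calc _ ≤ (d₁ : ℝ)⁻¹ * ((d₁ : ℝ)⁻¹ * (2 * (d₁ / 20)) ^ 2) := by gcongr
        _ = 1 / 100 := by field_simp; norm_num
  · simp only [T.leafProb_eq_pathProb]
    rw [sum_pathProb_mul κ n L]
    refine le_trans (le_of_eq ?_) hmean
    ring

end Main

/-! ### Parameter arithmetic and conclusion. -/

section Parameters

/-- The last hypothesis with `d₂ ≤ d₁` gives `a ≤ b` and then `d₁a ≤ d₂b`, so the lower block
carries a constant share of the trace. This turns `1/(d₂²b)` in the covariance into `4/d₂`. -/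
lemma one_le_of_trace_eq_one {d₁ d₂ : ℕ} {α : Fin d₁ → ℝ} {β : Fin d₂ → ℝ} {a b : ℝ}
    (hd : (d₂ : ℝ) ≤ d₁) (hd₂ : (0 : ℝ) < d₂) (ha : 0 < a) (hα : ∀ i, α i ≤ 2 * a) (hb : 0 < b)
    (hβ : ∀ j, β j ≤ 2 * b) (h1 : ∑ i, α i + ∑ j, β j = 1) (hab : d₁ * √a ≤ d₂ * √b) :
    1 ≤ 4 * (d₂ * b) := by
  have hαs : ∑ i, α i ≤ d₁ * (2 * a) := by
    simpa using Finset.sum_le_sum fun i (_ : i ∈ Finset.univ) => hα i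
  have hβs : ∑ j, β j ≤ d₂ * (2 * b) := by
    simpa using Finset.sum_le_sum fun i (_ : i ∈ Finset.univ) => hβ i
  have e1 : √a ≤ √b := by
    refine le_of_mul_le_mul_left (le_trans ?_ hab) hd₂
    exact mul_le_mul_of_nonneg_right hd (Real.sqrt_nonneg a)
  have e2 : d₁ * a ≤ d₂ * b := by
    calc d₁ * a = d₁ * √a * √a := by rw [mul_assoc, Real.mul_self_sqrt ha.le]
      _ ≤ d₂ * √b * √b := mul_le_mul hab e1 (Real.sqrt_nonneg a) (by positivity)
      _ = d₂ * b := by rw [mul_assoc, Real.mul_self_sqrt hb.le]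
  linarith

lemma six_mul_le_sqrt {d₁ d₂ : ℕ} {α : Fin d₁ → ℝ} {β : Fin d₂ → ℝ} {a b ε : ℝ}
    (hd : (4 : ℝ) ≤ d₁) (hd₂ : (0 : ℝ) < d₂) (ha : 0 < a) (hα : ∀ i, a ≤ α i) (hb : 0 < b)
    (hβ : ∀ j, b ≤ β j) (h1 : ∑ i, α i + ∑ j, β j = 1)
    (hε : ε ≤ 1 / 10 ^ 6 * (d₂ * √(a * b) / Real.log (1 / a))) :
    6 * (ε / d₂) ≤ √(a * b) := by
  have hαs : d₁ * a ≤ ∑ i, α i := by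
    simpa using Finset.sum_le_sum fun i (_ : i ∈ Finset.univ) => hα i
  have hβs : 0 ≤ ∑ j, β j := Finset.sum_nonneg fun j _ => hb.le.trans (hβ j)
  have hlog : 1 ≤ Real.log (1 / a) := by
    have e2 : 4 ≤ 1 / a := by rw [le_div_iff₀ ha]; nlinarith
    rw [Real.le_log_iff_exp_le (by positivity)]
    linarith [Real.exp_one_lt_d9]
  have e1 : d₂ * √(a * b) / Real.log (1 / a) ≤ d₂ * √(a * b) :=
    div_le_self (by positivity) hlog
  rw [mul_div_assoc', div_le_iff₀ hd₂]
  have e2 : 0 ≤ d₂ * √(a * b) := by positivity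
  linarith

/-- Everything rests on `Nq ≤ 16c√d`. The errors other than `2/d` add up to at most `52096c`, which
`c ≤ η/200000` makes less than `η/2`, and `d ≥ 8/η` leaves `η/4` for `2/d`. -/
lemma error_lt {d d₂ b ε c η N : ℝ} (hd : 4 ≤ d) (hd₂ : 0 < d₂) (hb : 0 < b)
    (hd₂b : 1 ≤ 4 * (d₂ * b)) (hε : 0 < ε) (hη : 0 < η) (hdη : 8 / η ≤ d) (hc0 : 0 < c)
    (hc1 : c ≤ 1) (hc2 : c ≤ η / 200000) (hN0 : 0 ≤ N) (hN : N < c * (√d * d₂ / ε ^ 2))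
    {q : ℝ} (hq : q = 4 * (ε / d₂) ^ 2 / b) :
    2 / d + (200 * (N * q) ^ 2 / d + 7 / (d * √d) * (N * (q * d))
      + (3 * (N * q) ^ 2 + N * q) / d) < η := by
  set r := √d
  have hr2 : r ^ 2 = d := Real.sq_sqrt (by linarith)
  have hr : 2 ≤ r := Real.le_sqrt_of_sq_le (by linarith)
  have hqle : q ≤ 16 * (ε ^ 2 / d₂) := by
    have e : q = 4 * (ε ^ 2 / d₂) / (d₂ * b) := by rw [hq]; field_simp
    rw [e, div_le_iff₀ (by positivity)]
    have : 0 ≤ ε ^ 2 / d₂ := by positivity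
    nlinarith
  have hq0 : 0 ≤ q := by rw [hq]; positivity
  have hNq : N * q ≤ 16 * c * r := by
    calc N * q ≤ c * (r * d₂ / ε ^ 2) * (16 * (ε ^ 2 / d₂)) :=
          mul_le_mul hN.le hqle hq0 (by positivity)
      _ = 16 * c * r := by field_simp
  have hNq0 : 0 ≤ N * q := by positivity
  have hNsq : (N * q) ^ 2 / d ≤ 256 * c := by
    rw [div_le_iff₀ (by positivity), ← hr2]
    calc (N * q) ^ 2 ≤ (16 * c * r) ^ 2 := pow_le_pow_left₀ hNq0 hNq 2
      _ = 256 * (c * c) * r ^ 2 := by ring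
      _ ≤ 256 * (c * 1) * r ^ 2 := by gcongr
      _ = _ := by ring
  have hN1 : 7 / (d * r) * (N * (q * d)) ≤ 112 * c := by
    have e : 7 / (d * r) * (N * (q * d)) = 7 * (N * q) / r := by field_simp
    rw [e, div_le_iff₀ (by positivity)]
    linarith
  have hN2 : N * q / d ≤ 16 * c := by
    rw [div_le_iff₀ (by positivity), ← hr2]
    refine hNq.trans ?_
    have : c * r ≤ c * r ^ 2 := by gcongr; nlinarith
    linarith
  have hD2 : 2 / d ≤ η / 4 := by
    rw [div_le_iff₀ hη] at hdη
    rw [div_le_iff₀ (by positivity)]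
    linarith
  have e1 : 200 * (N * q) ^ 2 / d = 200 * ((N * q) ^ 2 / d) := by ring
  have e2 : (3 * (N * q) ^ 2 + N * q) / d = 3 * ((N * q) ^ 2 / d) + N * q / d := by ring
  rw [e1, e2]
  linarith

end Parameters

theorem mainTheorem3 (p : ℝ) (hp : 1 / 2 < p) :
    ∃ c : ℝ, 0 < c ∧ ∃ D : ℕ,
      ∀ (d₁ d₂ : ℕ) (α : Fin d₁ → ℝ) (β : Fin d₂ → ℝ) (a b ε : ℝ),
        D ≤ d₁ → d₂ ≤ d₁ →
        0 < a → IsLeast (Set.range α) a → (∀ i, α i ≤ 2 * a) →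
        0 < b → IsLeast (Set.range β) b → (∀ j, β j ≤ 2 * b) →
        ∑ i, α i + ∑ j, β j = 1 →
        0 < ε → ε ≤ 1 / 10 ^ 6 * (d₂ * √(a * b) / Real.log (1 / a)) →
        d₁ * √a ≤ d₂ * √b →
        ∀ n : ℕ,
          CanDistinguish (nullState α β) (truncatedGinibre d₁ d₂) (altState α β ε) p n →
          c * (√(d₁ : ℝ) * d₂ / ε ^ 2) ≤ n := by
  obtain ⟨D₀, hD₀⟩ := exists_forall_coreEvent_ge
  have hηpos : 0 < (2 * p - 1) ^ 2 := pow_pos (by linarith) 2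
  obtain ⟨D₁, hD₁⟩ := exists_nat_ge (8 / (2 * p - 1) ^ 2)
  have hcpos : 0 < min 1 ((2 * p - 1) ^ 2 / 200000) := by positivity
  refine ⟨min 1 ((2 * p - 1) ^ 2 / 200000), hcpos, max (max D₀ D₁) 4, ?_⟩
  intro d₁ d₂ α β a b ε hD hd ha hαmin hα2 hb hβmin hβ2 h1 hε hεle hab n hcd
  have hdD₀ : D₀ ≤ d₁ := (le_max_left _ _).trans ((le_max_left _ _).trans hD)
  have hdD₁ : D₁ ≤ d₁ := (le_max_right _ _).trans ((le_max_left _ _).trans hD)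
  have hd4 : 4 ≤ d₁ := (le_max_right _ _).trans hD
  have hα : ∀ i, a ≤ α i := fun i => hαmin.2 ⟨i, rfl⟩
  have hβ : ∀ j, b ≤ β j := fun j => hβmin.2 ⟨j, rfl⟩
  obtain ⟨j₀, -⟩ := hβmin.1
  have hd₂ : 0 < d₂ := j₀.pos
  have hd4' : (4 : ℝ) ≤ d₁ := by exact_mod_cast hd4
  have hd₂' : (0 : ℝ) < d₂ := by exact_mod_cast hd₂
  have hdd : (d₂ : ℝ) ≤ d₁ := by exact_mod_cast hd
  by_contra hn
  have hmain := LearningTree.sq_le_of_canDistinguish hd4 hd₂ (hD₀ d₁ d₂ hdD₀ hd₂ hd) ha hb hα hβ h1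
    hε.le (six_mul_le_sqrt hd4' hd₂' ha hα hb hβ h1 hεle) hp hcd rfl
  exact absurd hmain (not_le.mpr (error_lt hd4' hd₂' hb
    (one_le_of_trace_eq_one hdd hd₂' ha hα2 hb hβ2 h1 hab) hε hηpos
    (hD₁.trans (by exact_mod_cast hdD₁)) hcpos (min_le_left _ _) (min_le_right _ _)
    (Nat.cast_nonneg _) (not_le.mp hn) rfl))
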